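/- Let $n\ge 3$ and let $(M,g)$ be a smooth (Hausdorff) $n$-manifold with a pseudo-Riemannian metric of arbitrary signature that is Einstein, i.e. $\mathrm{Ric}=c\,g$ for a constant $c\in\mathbb R$; let $\nabla$ be its Levi-Civita connection. *Projective side.* Let $\mathcal E(1)$ be the positive $(2n+2)$-th root of $(\Lambda^nTM)^2$ and $\mathcal T^*=J^1\mathcal E(1)$ the projective cotractor bundle, with projection $\mathcal T^*\to\mathcal E(1)$, whose kernel is $\mathcal E_a(1)=T^*M\otimes\mathcal E(1)$. By means of $\nabla$ write $j^1s=(\nabla s\mid s)$, so a cotractor is a pair $U=(\mu_a\mid\sigma)$. With $R_{ab}{}^c{}_dv^d=(\nabla_a\nabla_b-\nabla_b\nabla_a)v^c$ and $\mathrm{Ric}_{ab}=R_{ca}{}^c{}_b$, the projective Schouten tensor is $\mathsf P_{ab}=\frac{n\,\mathrm{Ric}_{ab}+\mathrm{Ric}_{ba}}{n^2-1}$, and the projective cotractor connection is $$\nabla_b(\mu_a\mid\sigma)=(\nabla_b\mu_a+\mathsf P_{ba}\sigma\mid\nabla_b\sigma-\mu_b).$$ A *sub-metric* is a smooth symmetric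 bilinear form on $\mathcal T^*$ whose restriction to $\mathcal E_a(1)$ is nondegenerate. *Conformal side.* Let $\mathcal E[1]$ be the positive $2n$-th root of $(\Lambda^nTM)^2$ and let $\widetilde{\mathcal T}^*$ be the conformal cotractor bundle, the quotient of $J^2\mathcal E[1]$ by the trace-free part of $S^2T^*M\otimes\mathcal E[1]=\ker(J^2\to J^1)$. Let $\widetilde{\mathsf P}$ be the conformal Schouten tensor, $\mathrm{Ric}=(n-2)\widetilde{\mathsf P}+\widetilde{\mathsf J}g$ with $\widetilde{\mathsf J}=g^{ab}\widetilde{\mathsf P}_{ab}$. Trivialise all density bundles by $g$. The metric gives the splitting $j^2s\mapsto(-\frac1n(\Delta s+\widetilde{\mathsf J}s)\mid\nabla s\mid s)$, so that a conformal cotractor is a triple $(\tau\mid\mu_a\mid\sigma)$; the conformal cotractor connection is $$\widetilde\nabla_b(\tau\mid\mu_a\mid\sigma)=(\nabla_b\tau-\widetilde{\mathsf P}_{bc}g^{ca}\mu_a\mid\nabla_b\mu_a+g_{ba}\tau+\widetilde{\mathsf P}_{ba}\sigma\mid\nabla_b\sigma-\mu_b),$$ and the conformal tractor metric on cotractors is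 $\widetilde h\big((\tau\mid\mu\mid\sigma),(\tau'\mid\mu'\mid\sigma')\big)=g^{ab}\mu_a\mu'_b+\sigma\tau'+\tau\sigma'$. Let $I=(1,0,-\frac1n\widetilde{\mathsf J})$, the section of the dual bundle with $I(\tau\mid\mu\mid\sigma)=\tau-\frac1n\widetilde{\mathsf J}\sigma$. Define $\iota:\mathcal T^*\to\widetilde{\mathcal T}^*$ by $$\iota(\mu_a\mid\sigma)=\big(\tfrac1n\widetilde{\mathsf J}\,\sigma\mid\mu_a\mid\sigma\big).$$ Then: 1. $I$ is parallel for the connection dual to $\widetilde\nabla$. 2. $\iota$ is a smooth injective bundle map, and its image is the kernel of $I$ in every fibre. 3. $\iota$ is connection-preserving: $\widetilde\nabla_X(\iota U)=\iota(\nabla_XU)$ for every smooth section $U$ of $\mathcal T^*$ and every tangent vector $X$. 4. There is a constant $\lambda$ with $\mathsf P_{ab}=\lambda g_{ab}$; the form $h\big((\mu\mid\sigma),(\mu'\mid\sigma')\big)=g^{ab}\mu_a\mu'_b+\lambda\sigma\sigma'$ is a sub-metric on $\mathcal T^*$ (the sub-metric associated with the Einstein metric $g$), it is parallel for the projective tractor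 connection, and it is the pull-back of the conformal tractor metric: $\widetilde h(\iota U,\iota U')=h(U,U')$ for all $U,U'\in\mathcal T^*_x$, $x\in M$. -/

import Mathlib

open Bundle Module
open scoped Manifold ContDiff Topology

noncomputable section

namespace Tractor

variable {n : ℕ} {M : Type*} [TopologicalSpace M] [ChartedSpace (EuclideanSpace ℝ (Fin n)) M]

section Frames

/-- The standard basis of `T_x M = ℝⁿ`; it is the basis of coordinate vectors at `x` of the
preferred chart at `x`. -/
def stdBasis (n : ℕ) {M : Type*} [TopologicalSpace M] [ChartedSpace (EuclideanSpace ℝ (Fin n)) M]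
    (x : M) : Basis (Fin n) ℝ (TangentSpace (𝓡 n) x) :=
  (EuclideanSpace.basisFun (Fin n) ℝ).toBasis

lemma det_ne_zero_of_linearIndependent {x : M} {v : Fin n → TangentSpace (𝓡 n) x}
    (hv : LinearIndependent ℝ v) : (stdBasis n x).det v ≠ 0 := by
  have : FiniteDimensional ℝ (TangentSpace (𝓡 n) x) := (stdBasis n x).finiteDimensional_of_finite
  exact ((Basis.is_basis_iff_det (stdBasis n x)).1
    ⟨hv, hv.span_eq_top_of_card_eq_finrank' (finrank_eq_card_basis (stdBasis n x)).symm⟩).ne_zero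

variable [IsManifold (𝓡 n) ∞ M]

/-- The vector field with constant coefficients `v` in the preferred chart at `x`
(and the junk value `0` off the domain of that chart). Its value at `x` is `v`. -/
def coordField (x : M) (v : TangentSpace (𝓡 n) x) (y : M) : TangentSpace (𝓡 n) y :=
  (trivializationAt (EuclideanSpace ℝ (Fin n)) (TangentSpace (𝓡 n)) x).symmL ℝ y v

/-- The frame of coordinate vector fields of the preferred chart at `x`. -/
def coordFrame (x : M) (y : M) (i : Fin n) : TangentSpace (𝓡 n) y :=
  coordField x (stdBasis n x i) y

lemma coordField_self (x : M) (v : TangentSpace (𝓡 n) x) : coordField x v x = v := by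
  unfold coordField
  rw [TangentBundle.symmL_trivializationAt_eq_core (I := 𝓡 n) (M := M) (b₀ := x) (b := x)
    (mem_chart_source (EuclideanSpace ℝ (Fin n)) x)]
  simpa using! (tangentBundleCore (𝓡 n) M).coordChange_self (achart _ x) x (mem_chart_source _ x) v

lemma coordFrame_self (x : M) : coordFrame x x = stdBasis n x := by
  funext i; exact coordField_self x _

lemma contMDiffAt_coordField (x : M) (v : TangentSpace (𝓡 n) x) {y : M}
    (hy : y ∈ (chartAt (EuclideanSpace ℝ (Fin n)) x).source) :
    ContMDiffAt (𝓡 n) ((𝓡 n).prod 𝓘(ℝ, EuclideanSpace ℝ (Fin n))) ∞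
      (fun z ↦ TotalSpace.mk' (EuclideanSpace ℝ (Fin n)) z (coordField x v z)) y := by
  have hy' : y ∈ (trivializationAt (EuclideanSpace ℝ (Fin n)) (TangentSpace (𝓡 n)) x).baseSet := by
    simpa using hy
  rw [(trivializationAt (EuclideanSpace ℝ (Fin n)) (TangentSpace (𝓡 n)) x).contMDiffAt_section_iff
    hy']
  let w : EuclideanSpace ℝ (Fin n) := v
  refine (contMDiffAt_const (c := w)).congr_of_eventuallyEq ?_
  filter_upwards [(trivializationAt (EuclideanSpace ℝ (Fin n))
    (TangentSpace (𝓡 n)) x).open_baseSet.mem_nhds hy'] with z hz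
  have := (trivializationAt (EuclideanSpace ℝ (Fin n))
    (TangentSpace (𝓡 n)) x).continuousLinearMapAt_symmL (R := ℝ) hz v
  rw [Trivialization.continuousLinearMapAt_apply,
    Trivialization.linearMapAt_apply, if_pos hz] at this
  exact this

lemma det_coordFrame_ne_zero (x : M) {y : M}
    (hy : y ∈ (chartAt (EuclideanSpace ℝ (Fin n)) x).source) :
    (stdBasis n y).det (coordFrame x y) ≠ 0 := by
  have hy' : y ∈ (trivializationAt (EuclideanSpace ℝ (Fin n)) (TangentSpace (𝓡 n)) x).baseSet := by
    simpa using hy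
  have hinj : Function.Injective ((trivializationAt (EuclideanSpace ℝ (Fin n))
      (TangentSpace (𝓡 n)) x).symmL ℝ y) :=
    Function.LeftInverse.injective (g := (trivializationAt (EuclideanSpace ℝ (Fin n))
      (TangentSpace (𝓡 n)) x).continuousLinearMapAt ℝ y)
      (fun v ↦ Trivialization.continuousLinearMapAt_symmL _ hy' v)
  have hli : LinearIndependent ℝ (coordFrame x y) :=
    (stdBasis n x).linearIndependent.map' (((trivializationAt (EuclideanSpace ℝ (Fin n))
      (TangentSpace (𝓡 n)) x).symmL ℝ y).toLinearMap) (LinearMap.ker_eq_bot.2 hinj)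
  exact det_ne_zero_of_linearIndependent hli

end Frames

section Densities

/-- The fibre at `x` of the line bundle `((Λⁿ TM)²)^(r/2)`, the positive root being taken:
an element is given by its coefficient `s v` with respect to `|v₁ ∧ ⋯ ∧ vₙ|^r`, for each basis
`v` of `T_x M` (with the junk value `0` when `v` is not a basis). -/
def densitySubmodule (n : ℕ) {M : Type*} [TopologicalSpace M]
    [ChartedSpace (EuclideanSpace ℝ (Fin n)) M] (r : ℝ) (x : M) :
    Submodule ℝ ((Fin n → TangentSpace (𝓡 n) x) → ℝ) where
  carrier := {s | (∀ v, ¬ LinearIndependent ℝ v → s v = 0) ∧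
    ∀ (A : TangentSpace (𝓡 n) x ≃ₗ[ℝ] TangentSpace (𝓡 n) x) (v : Fin n → TangentSpace (𝓡 n) x),
      s (fun i ↦ A (v i)) = |LinearMap.det (A : TangentSpace (𝓡 n) x →ₗ[ℝ] TangentSpace (𝓡 n) x)|
        ^ (-r) * s v}
  add_mem' := by
    rintro s t ⟨hs, hs'⟩ ⟨ht, ht'⟩
    exact ⟨fun v hv ↦ by simp [hs v hv, ht v hv], fun A v ↦ by simp [hs' A v, ht' A v, mul_add]⟩
  zero_mem' := ⟨fun _ _ ↦ rfl, fun _ _ ↦ by simp⟩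
  smul_mem' := by
    rintro c s ⟨hs, hs'⟩
    exact ⟨fun v hv ↦ by simp [hs v hv], fun A v ↦ by simp [hs' A v, mul_left_comm]⟩

/-- The fibre at `x` of the density bundle `((Λⁿ TM)²)^(r/2)`. -/
def Density (n : ℕ) {M : Type*} [TopologicalSpace M]
    [ChartedSpace (EuclideanSpace ℝ (Fin n)) M] (r : ℝ) (x : M) : Type :=
  densitySubmodule n r x

instance (r : ℝ) (x : M) : AddCommGroup (Density n r x) :=
  inferInstanceAs (AddCommGroup (densitySubmodule n r x))

instance (r : ℝ) (x : M) : Module ℝ (Density n r x) :=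
  inferInstanceAs (Module ℝ (densitySubmodule n r x))

/-- The coefficient of a density with respect to `|v₁ ∧ ⋯ ∧ vₙ|^r`, as a linear form on the
densities. -/
def Density.coeff {r : ℝ} {x : M} (v : Fin n → TangentSpace (𝓡 n) x) : Density n r x →ₗ[ℝ] ℝ :=
  LinearMap.proj v ∘ₗ (densitySubmodule n r x).subtype

lemma Density.apply_eq {r : ℝ} {x : M} (s : Density n r x) {v : Fin n → TangentSpace (𝓡 n) x}
    (hv : (stdBasis n x).det v ≠ 0) :
    Density.coeff v s = |(stdBasis n x).det v| ^ (-r) * Density.coeff (stdBasis n x) s := by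
  obtain ⟨hli, hsp⟩ := (Basis.is_basis_iff_det (stdBasis n x)).2 (isUnit_iff_ne_zero.2 hv)
  have h := s.2.2 ((stdBasis n x).equiv (Basis.mk hli hsp.ge) (Equiv.refl _)) (stdBasis n x)
  have h1 : (fun i ↦ (stdBasis n x).equiv (Basis.mk hli hsp.ge) (Equiv.refl _)
      (stdBasis n x i)) = v := by
    funext i; simp
  have h2 : LinearMap.det (((stdBasis n x).equiv (Basis.mk hli hsp.ge) (Equiv.refl _) :
      TangentSpace (𝓡 n) x ≃ₗ[ℝ] TangentSpace (𝓡 n) x) :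
      TangentSpace (𝓡 n) x →ₗ[ℝ] TangentSpace (𝓡 n) x) = (stdBasis n x).det v := by
    have h3 := Basis.det_comp (stdBasis n x) (((stdBasis n x).equiv (Basis.mk hli hsp.ge)
      (Equiv.refl _) : TangentSpace (𝓡 n) x ≃ₗ[ℝ] TangentSpace (𝓡 n) x) :
      TangentSpace (𝓡 n) x →ₗ[ℝ] TangentSpace (𝓡 n) x) (stdBasis n x)
    rw [Basis.det_self, mul_one] at h3
    rw [← h3]
    exact congrArg _ h1
  rw [h1, h2] at h
  exact h

open Classical in
/-- The density whose coefficient with respect to the standard basis of `T_x M` is `1`. -/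
def stdDensity (n : ℕ) {M : Type*} [TopologicalSpace M] [ChartedSpace (EuclideanSpace ℝ (Fin n)) M]
    (r : ℝ) (x : M) : Density n r x :=
  ⟨fun v ↦ if (stdBasis n x).det v = 0 then 0 else |(stdBasis n x).det v| ^ (-r), by
    refine ⟨fun v hv ↦ if_pos ?_, fun A v ↦ ?_⟩
    · by_contra h
      exact hv ((Basis.is_basis_iff_det (stdBasis n x)).2 (isUnit_iff_ne_zero.2 h)).1
    · have hA : LinearMap.det (A : TangentSpace (𝓡 n) x →ₗ[ℝ] TangentSpace (𝓡 n) x) ≠ 0 :=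
        (LinearEquiv.isUnit_det' A).ne_zero
      have hd : (stdBasis n x).det (fun i ↦ A (v i)) =
          LinearMap.det (A : TangentSpace (𝓡 n) x →ₗ[ℝ] TangentSpace (𝓡 n) x) *
          (stdBasis n x).det v :=
        Basis.det_comp (stdBasis n x) (A : TangentSpace (𝓡 n) x →ₗ[ℝ] TangentSpace (𝓡 n) x) v
      by_cases h : (stdBasis n x).det v = 0
      · simp [hd, h]
      · simp only [hd, h, mul_eq_zero, hA, or_self, if_false, abs_mul]
        exact Real.mul_rpow (abs_nonneg _) (abs_nonneg _)⟩

lemma stdDensity_stdBasis (r : ℝ) (x : M) : Density.coeff (stdBasis n x) (stdDensity n r x) = 1 := by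
  change (if (stdBasis n x).det (stdBasis n x) = 0 then (0 : ℝ)
    else |(stdBasis n x).det (stdBasis n x)| ^ (-r)) = 1
  simp [Basis.det_self]

lemma Density.eq_smul {r : ℝ} {x : M} (s : Density n r x) :
    s = Density.coeff (stdBasis n x) s • stdDensity n r x := by
  refine Subtype.ext (funext fun v ↦ ?_)
  change Density.coeff v s = Density.coeff v (Density.coeff (stdBasis n x) s • stdDensity n r x)
  by_cases h : (stdBasis n x).det v = 0
  · have hv : ¬ LinearIndependent ℝ v := fun hli ↦
      det_ne_zero_of_linearIndependent hli h
    exact (s.2.1 v hv).trans ((Density.coeff (stdBasis n x) s • stdDensity n r x).2.1 v hv).symm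
  · rw [Density.apply_eq s h, Density.apply_eq (Density.coeff (stdBasis n x) s • stdDensity n r x) h]
    simp [stdDensity_stdBasis]


/-- A real function on `M`, read in the preferred chart at `x`. -/
def inChart (f : M → ℝ) (x : M) : EuclideanSpace ℝ (Fin n) → ℝ :=
  f ∘ (extChartAt (𝓡 n) x).symm

lemma contDiffAt_inChart {f : M → ℝ} {x : M} (hf : ContMDiffAt (𝓡 n) 𝓘(ℝ, ℝ) ∞ f x) :
    ContDiffAt ℝ ∞ (inChart f x) (extChartAt (𝓡 n) x x) := by
  rw [contMDiffAt_iff] at hf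
  simpa [inChart, contDiffWithinAt_univ] using! hf.2

lemma mvfderiv_eq_fderiv_inChart {f : M → ℝ} {x : M} (hf : MDifferentiableAt (𝓡 n) 𝓘(ℝ, ℝ) f x)
    (v : TangentSpace (𝓡 n) x) :
    mvfderiv (𝓡 n) f x v = fderiv ℝ (inChart f x) (extChartAt (𝓡 n) x x) v := by
  simp only [mvfderiv, mfderiv, hf]
  simp [writtenInExtChartAt, inChart, fderivWithin_univ]
  rfl

variable [IsManifold (𝓡 n) ∞ M]

/-- The coefficient of a section `s` of a density bundle in the coordinate frame of the preferred
chart at `x`. -/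
def coordCoeff {r : ℝ} (s : Π y : M, Density n r y) (x : M) : M → ℝ :=
  fun y ↦ Density.coeff (coordFrame x y) (s y)

/-- Smooth sections of the density bundle. -/
def SmoothDensity (n : ℕ) (M : Type*) [TopologicalSpace M]
    [ChartedSpace (EuclideanSpace ℝ (Fin n)) M] [IsManifold (𝓡 n) ∞ M] (r : ℝ) :
    Submodule ℝ (Π x : M, Density n r x) where
  carrier := {s | ∀ x, ContMDiffAt (𝓡 n) 𝓘(ℝ, ℝ) ∞ (coordCoeff s x) x}
  add_mem' hs ht x := by
    simpa only [coordCoeff, Pi.add_apply, map_add] using! (hs x).add (ht x)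
  zero_mem' x := by
    simpa only [coordCoeff, Pi.zero_apply, map_zero] using! contMDiffAt_const
  smul_mem' c s hs x := by
    simpa only [coordCoeff, Pi.smul_apply, map_smul] using! contMDiffAt_const.mul (hs x)

/-- The smooth sections whose `k`-jet at `x` vanishes. -/
def jetVanish (n : ℕ) {M : Type*} [TopologicalSpace M]
    [ChartedSpace (EuclideanSpace ℝ (Fin n)) M] [IsManifold (𝓡 n) ∞ M] (r : ℝ) (k : ℕ) (x : M) :
    Submodule ℝ (SmoothDensity n M r) where
  carrier := {s | ∀ j ≤ k,
    iteratedFDeriv ℝ j (inChart (coordCoeff s.1 x) x) (extChartAt (𝓡 n) x x) = 0}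
  add_mem' {s t} hs ht j hj := by
    have := iteratedFDeriv_add_apply (i := j) (𝕜 := ℝ)
      ((contDiffAt_inChart (s.2 x)).of_le (by exact_mod_cast le_top))
      ((contDiffAt_inChart (t.2 x)).of_le (by exact_mod_cast le_top))
    rw [hs j hj, ht j hj, add_zero] at this
    exact this
  zero_mem' j _ := by
    have : inChart (coordCoeff (0 : SmoothDensity n M r).1 x) x =
        (0 : EuclideanSpace ℝ (Fin n) → ℝ) := rfl
    rw [this, iteratedFDeriv_zero]; rfl
  smul_mem' c s hs j hj := by
    have := iteratedFDeriv_const_smul_apply (i := j) (𝕜 := ℝ) (a := c)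
      ((contDiffAt_inChart (s.2 x)).of_le (by exact_mod_cast le_top))
    rw [hs j hj, smul_zero] at this
    exact this

/-- The fibre at `x` of the bundle of `k`-jets of sections of the density bundle. -/
abbrev Jet (n : ℕ) {M : Type*} [TopologicalSpace M]
    [ChartedSpace (EuclideanSpace ℝ (Fin n)) M] [IsManifold (𝓡 n) ∞ M] (r : ℝ) (k : ℕ) (x : M) :
    Type _ :=
  SmoothDensity n M r ⧸ jetVanish n r k x

end Densities

section Connections

/-- Affine connections on `M`; `∇ Y x X` is `∇_X Y` at `x`. -/
abbrev AffineConnection (n : ℕ) (M : Type*) [TopologicalSpace M]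
    [ChartedSpace (EuclideanSpace ℝ (Fin n)) M] [IsManifold (𝓡 n) ∞ M] :=
  CovariantDerivative (𝓡 n) (EuclideanSpace ℝ (Fin n)) (TangentSpace (𝓡 n) : M → Type _)

variable [IsManifold (𝓡 n) ∞ M] (nabla : AffineConnection n M)

/-- The trace of the connection form in the coordinate frame at `x`:
`X ↦ ∑ᵢ (∇_X Eᵢ)ⁱ`. -/
def connTrace (x : M) : TangentSpace (𝓡 n) x →ₗ[ℝ] ℝ :=
  ∑ i, (stdBasis n x).coord i ∘ₗ
    (nabla (fun y ↦ coordFrame x y i) x : TangentSpace (𝓡 n) x →ₗ[ℝ] TangentSpace (𝓡 n) x)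

/-- The connection induced by `∇` on the density bundle. If `s` has coefficient `c` in a local frame
`E`, then `∇_X s` has coefficient `X c + r ∑ᵢ (∇_X Eᵢ)ⁱ c`. -/
def densityDeriv {r : ℝ} (s : Π y : M, Density n r y) (x : M) :
    TangentSpace (𝓡 n) x →ₗ[ℝ] Density n r x :=
  LinearMap.smulRight
    ((mvfderiv (𝓡 n) (coordCoeff s x) x : TangentSpace (𝓡 n) x →ₗ[ℝ] ℝ) +
      (r * coordCoeff s x x) • connTrace nabla x)
    (stdDensity n r x)

/-- The curvature `R(X, Y) Z = ∇_X ∇_Y Z - ∇_Y ∇_X Z - ∇_[X,Y] Z` on vector fields. -/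
def curvature (X Y Z : Π x : M, TangentSpace (𝓡 n) x) (x : M) : TangentSpace (𝓡 n) x :=
  nabla (fun y ↦ nabla Z y (Y y)) x (X x) - nabla (fun y ↦ nabla Z y (X y)) x (Y x) -
    nabla Z x (VectorField.mlieBracket (𝓡 n) X Y x)

/-- The Ricci tensor `Ric(u, v) = tr (w ↦ R(w, u) v)`. -/
def ricci (x : M) (u v : TangentSpace (𝓡 n) x) : ℝ :=
  ∑ i, (stdBasis n x).coord i
    (curvature nabla (fun y ↦ coordFrame x y i) (coordField x u) (coordField x v) x)

/-- The projective Schouten tensor `P` of a torsion-free connection, the solution of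
`(n - 1) P(u, v) = Ric(u, v) + β(u, v)` with `β(u, v) = P(v, u) - P(u, v)`. -/
def projSchouten (x : M) (u v : TangentSpace (𝓡 n) x) : ℝ :=
  (n * ricci nabla x u v + ricci nabla x v u) / ((n : ℝ) ^ 2 - 1)

/-- The covariant derivative of a 1-form: `(∇_X μ)(v) = X (μ V) - μ (∇_X V)`, for `v` running
through the standard basis of `T_x M` and its extensions `V` with constant coefficients in the
chart at `x`. -/
def formDeriv (μ : Π y : M, TangentSpace (𝓡 n) y →ₗ[ℝ] ℝ) (x : M) (X : TangentSpace (𝓡 n) x) :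
    TangentSpace (𝓡 n) x →ₗ[ℝ] ℝ :=
  (stdBasis n x).constr ℝ fun i ↦
    mvfderiv (𝓡 n) (fun y ↦ μ y (coordFrame x y i)) x X -
      μ x (nabla (fun y ↦ coordFrame x y i) x X)

/-- The covariant derivative of a density-valued 1-form:
`(∇_X μ)(v) = ∇_X (μ V) - μ (∇_X V)`, with `v` and `V` as for 1-forms. -/
def densityFormDeriv {r : ℝ} (μ : Π y : M, TangentSpace (𝓡 n) y →ₗ[ℝ] Density n r y) (x : M)
    (X : TangentSpace (𝓡 n) x) : TangentSpace (𝓡 n) x →ₗ[ℝ] Density n r x :=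
  (stdBasis n x).constr ℝ fun i ↦
    densityDeriv nabla (fun y ↦ μ y (coordFrame x y i)) x X -
      μ x (nabla (fun y ↦ coordFrame x y i) x X)

end Connections

section Metrics

/-- Smooth pseudo-Riemannian metrics, of any signature. -/
structure PseudoMetric (n : ℕ) (M : Type*) [TopologicalSpace M]
    [ChartedSpace (EuclideanSpace ℝ (Fin n)) M] [IsManifold (𝓡 n) ∞ M] where
  /-- The bilinear form on the tangent space at `x`. -/
  val (x : M) : TangentSpace (𝓡 n) x →L[ℝ] TangentSpace (𝓡 n) x →L[ℝ] ℝ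
  symm (x : M) (u v : TangentSpace (𝓡 n) x) : val x u v = val x v u
  nondegenerate (x : M) (u : TangentSpace (𝓡 n) x) (hu : ∀ v, val x u v = 0) : u = 0
  contMDiff : ContMDiff (𝓡 n)
    ((𝓡 n).prod 𝓘(ℝ, EuclideanSpace ℝ (Fin n) →L[ℝ] EuclideanSpace ℝ (Fin n) →L[ℝ] ℝ)) ∞
    (fun x ↦ TotalSpace.mk' (EuclideanSpace ℝ (Fin n) →L[ℝ] EuclideanSpace ℝ (Fin n) →L[ℝ] ℝ)
      (E := fun x : M ↦ (TangentSpace (𝓡 n) x →L[ℝ] TangentSpace (𝓡 n) x →L[ℝ] ℝ)) x (val x))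

variable [IsManifold (𝓡 n) ∞ M] (g : PseudoMetric n M) (nabla : AffineConnection n M)

/-- `∇` is the Levi-Civita connection of `g`. -/
structure IsLeviCivita : Prop where
  smooth : CovariantDerivative.ContMDiffCovariantDerivative nabla ∞
  torsion_eq_zero : nabla.torsion = 0
  metric (x : M) (X : TangentSpace (𝓡 n) x) (Y Z : Π y : M, TangentSpace (𝓡 n) y)
    (hY : MDifferentiableAt (𝓡 n) ((𝓡 n).prod 𝓘(ℝ, EuclideanSpace ℝ (Fin n)))
      (fun y ↦ TotalSpace.mk' (EuclideanSpace ℝ (Fin n)) y (Y y)) x)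
    (hZ : MDifferentiableAt (𝓡 n) ((𝓡 n).prod 𝓘(ℝ, EuclideanSpace ℝ (Fin n)))
      (fun y ↦ TotalSpace.mk' (EuclideanSpace ℝ (Fin n)) y (Z y)) x) :
    mvfderiv (𝓡 n) (fun y ↦ g.val y (Y y) (Z y)) x X =
      g.val x (nabla Y x X) (Z x) + g.val x (Y x) (nabla Z x X)

/-- The Gram matrix of a family of vectors. -/
def gram (x : M) (v : Fin n → TangentSpace (𝓡 n) x) : Matrix (Fin n) (Fin n) ℝ :=
  Matrix.of fun i j ↦ g.val x (v i) (v j)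

/-- The components `gⁱʲ` of the inverse metric in the standard basis of `T_x M`. -/
def gInv (x : M) : Matrix (Fin n) (Fin n) ℝ := (gram g x (stdBasis n x))⁻¹

/-- The inverse metric on 1-forms. -/
def cometric (x : M) (μ ν : TangentSpace (𝓡 n) x →ₗ[ℝ] ℝ) : ℝ :=
  ∑ i, ∑ j, gInv g x i j * μ (stdBasis n x i) * ν (stdBasis n x j)

/-- The metric trace `gⁱʲ B(eᵢ, eⱼ)`. -/
def metricTrace (x : M) (B : TangentSpace (𝓡 n) x → TangentSpace (𝓡 n) x → ℝ) : ℝ :=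
  ∑ i, ∑ j, gInv g x i j * B (stdBasis n x i) (stdBasis n x j)

/-- The trace `J̃ = Scal / (2 (n - 1))` of the conformal Schouten tensor. -/
def confJ (x : M) : ℝ := metricTrace g x (ricci nabla x) / (2 * ((n : ℝ) - 1))

/-- The conformal Schouten tensor `P̃`, determined by `Ric = (n - 2) P̃ + J̃ g`. -/
def confSchouten (x : M) (u v : TangentSpace (𝓡 n) x) : ℝ :=
  (ricci nabla x u v - confJ g nabla x * g.val x u v) / ((n : ℝ) - 2)

/-- The trivialisation of the density bundle by the metric `g`: the coefficient of a density with
respect to `|v₁ ∧ ⋯ ∧ vₙ|^r` for `v` a `g`-orthonormal basis. It is computed in the standard basis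
`e`, where `|det g(eᵢ, eⱼ)|^(r/2)` is the corresponding factor. -/
def scale (r : ℝ) (x : M) : Density n r x →ₗ[ℝ] ℝ where
  toFun s := |(gram g x (stdBasis n x)).det| ^ (r / 2) * Density.coeff (stdBasis n x) s
  map_add' _ _ := mul_add _ _ _
  map_smul' _ _ := mul_left_comm _ _ _

/-- The differential of a function as a 1-form. -/
def differential (f : M → ℝ) (x : M) : TangentSpace (𝓡 n) x →ₗ[ℝ] ℝ :=
  (mvfderiv (𝓡 n) f x : TangentSpace (𝓡 n) x →ₗ[ℝ] ℝ)

/-- The Laplacian `gᵃᵇ ∇ₐ ∇_b f`. -/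
def laplacian (f : M → ℝ) (x : M) : ℝ :=
  metricTrace g x fun u v ↦ formDeriv nabla (fun y ↦ differential f y) x u v

end Metrics

section Existence

lemma contMDiffAt_det {A : M → Fin n → Fin n → ℝ} {x : M}
    (hA : ∀ i j, ContMDiffAt (𝓡 n) 𝓘(ℝ, ℝ) ∞ (fun y ↦ A y i j) x) :
    ContMDiffAt (𝓡 n) 𝓘(ℝ, ℝ) ∞ (fun y ↦ (Matrix.of (A y)).det) x := by
  simp only [Matrix.det_apply, Matrix.of_apply]
  refine contMDiffAt_finsetSum fun σ _ ↦ ?_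
  have h : ContMDiffAt (𝓡 n) 𝓘(ℝ, ℝ) ∞ (fun y ↦ ∏ i, A y (σ i) i) x :=
    contMDiffAt_finsetProd fun i _ ↦ hA (σ i) i
  have h2 := (contMDiffAt_const (c := ((Equiv.Perm.sign σ : ℤ) : ℝ))).mul h
  refine h2.congr_of_eventuallyEq (Filter.Eventually.of_forall fun y ↦ ?_)
  simp [Units.smul_def]

lemma contMDiffAt_abs_rpow {f : M → ℝ} {x : M} (hf : ContMDiffAt (𝓡 n) 𝓘(ℝ, ℝ) ∞ f x)
    (h0 : f x ≠ 0) (r : ℝ) : ContMDiffAt (𝓡 n) 𝓘(ℝ, ℝ) ∞ (fun y ↦ |f y| ^ r) x := by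
  have h : ContDiffAt ℝ ∞ (fun t : ℝ ↦ |t| ^ r) (f x) :=
    (contDiffAt_abs h0).rpow contDiffAt_const (abs_ne_zero.2 h0)
  exact h.contMDiffAt.comp x hf

variable [IsManifold (𝓡 n) ∞ M]

lemma contMDiffAt_det_ratio (x : M) {z : M}
    (hz : z ∈ (chartAt (EuclideanSpace ℝ (Fin n)) x).source) :
    ContMDiffAt (𝓡 n) 𝓘(ℝ, ℝ) ∞ (fun y ↦ (stdBasis n y).det (coordFrame x y) /
      (stdBasis n y).det (coordFrame z y)) z := by
  set e := trivializationAt (EuclideanSpace ℝ (Fin n)) (TangentSpace (𝓡 n) : M → Type _) z with he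
  have hze : z ∈ e.baseSet := mem_baseSet_trivializationAt _ _ z
  have hw : ∀ i, ContMDiffAt (𝓡 n) 𝓘(ℝ, EuclideanSpace ℝ (Fin n)) ∞
      (fun y ↦ (e ⟨y, coordFrame x y i⟩).2) z := fun i ↦
    (e.contMDiffAt_section_iff hze).1 (contMDiffAt_coordField x (stdBasis n x i) hz)
  have hw' : ∀ i j, ContMDiffAt (𝓡 n) 𝓘(ℝ, ℝ) ∞
      (fun y ↦ (e ⟨y, coordFrame x y j⟩).2 i) z := fun i j ↦
    ((EuclideanSpace.proj (𝕜 := ℝ) i : EuclideanSpace ℝ (Fin n) →L[ℝ] ℝ).contMDiff.contMDiffAt).comp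
      z (hw j)
  refine (contMDiffAt_det hw').congr_of_eventuallyEq ?_
  filter_upwards [e.open_baseSet.mem_nhds hze] with y hy
  let A : EuclideanSpace ℝ (Fin n) →ₗ[ℝ] EuclideanSpace ℝ (Fin n) := (e.symmL ℝ y).toLinearMap
  have h1 : (stdBasis n y).det (coordFrame x y) = LinearMap.det A *
      (EuclideanSpace.basisFun (Fin n) ℝ).toBasis.det (fun i ↦ (e ⟨y, coordFrame x y i⟩).2) := by
    rw [← Basis.det_comp]
    change (EuclideanSpace.basisFun (Fin n) ℝ).toBasis.det _ = _
    congr 1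
    funext i
    have := e.symmL_continuousLinearMapAt (R := ℝ) hy (coordFrame x y i)
    rw [Trivialization.continuousLinearMapAt_apply, Trivialization.linearMapAt_apply,
      if_pos hy] at this
    exact this.symm
  have h2 : (stdBasis n y).det (coordFrame z y) = LinearMap.det A := by
    have h := Basis.det_comp (EuclideanSpace.basisFun (Fin n) ℝ).toBasis A
      (EuclideanSpace.basisFun (Fin n) ℝ).toBasis
    rw [Basis.det_self, mul_one] at h
    exact h
  have h3 : LinearMap.det A ≠ 0 := by
    rw [← h2]
    exact det_coordFrame_ne_zero z (by simpa [he] using hy)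
  rw [h1, h2, mul_div_cancel_left₀ _ h3]
  rfl

lemma coordCoeff_smul_stdDensity {r : ℝ} (k : M → ℝ) (x : M) {y : M}
    (hy : y ∈ (chartAt (EuclideanSpace ℝ (Fin n)) x).source) :
    coordCoeff (fun z ↦ k z • stdDensity n r z) x y =
      k y * |(stdBasis n y).det (coordFrame x y)| ^ (-r) := by
  have := Density.apply_eq (k y • stdDensity n r y) (det_coordFrame_ne_zero x hy)
  rw [coordCoeff, this, map_smul, stdDensity_stdBasis, smul_eq_mul, mul_one, mul_comm]

lemma exists_smoothDensity [T2Space M] (r : ℝ) (x : M) {q : EuclideanSpace ℝ (Fin n) → ℝ}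
    (hq : ContDiff ℝ ∞ q) : ∃ s : SmoothDensity n M r,
      inChart (coordCoeff s.1 x) x =ᶠ[𝓝 (extChartAt (𝓡 n) x x)] q := by
  let B : SmoothBumpFunction (𝓡 n) x := Classical.arbitrary _
  let h : M → ℝ := fun y ↦ B y • q (extChartAt (𝓡 n) x y)
  have hh : ContMDiff (𝓡 n) 𝓘(ℝ, ℝ) ∞ h := by
    refine B.contMDiff_smul fun y hy ↦ ?_
    exact (hq.contMDiff.contMDiffAt.comp y
      (contMDiffAt_extChartAt' (by simpa using hy))).contMDiffWithinAt
  let s : Π y : M, Density n r y := fun y ↦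
    (h y * |(stdBasis n y).det (coordFrame x y)| ^ r) • stdDensity n r y
  have hs : ∀ z, ContMDiffAt (𝓡 n) 𝓘(ℝ, ℝ) ∞ (coordCoeff s z) z := by
    intro z
    have hzn : (chartAt (EuclideanSpace ℝ (Fin n)) z).source ∈ 𝓝 z :=
      (chartAt _ z).open_source.mem_nhds (mem_chart_source _ z)
    by_cases hz : z ∈ tsupport B
    · have hzx : z ∈ (chartAt (EuclideanSpace ℝ (Fin n)) x).source :=
        B.tsupport_subset_chartAt_source hz
      have h0 : (stdBasis n z).det (coordFrame x z) /
          (stdBasis n z).det (coordFrame z z) ≠ 0 :=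
        div_ne_zero (det_coordFrame_ne_zero x hzx)
          (det_coordFrame_ne_zero z (mem_chart_source _ z))
      refine (hh.contMDiffAt.mul
        (contMDiffAt_abs_rpow (contMDiffAt_det_ratio x hzx) h0 r)).congr_of_eventuallyEq ?_
      filter_upwards [hzn] with y hy
      rw [coordCoeff_smul_stdDensity _ z hy]
      simp only [Pi.mul_apply]
      rw [abs_div, Real.div_rpow (abs_nonneg _) (abs_nonneg _), Real.rpow_neg (abs_nonneg _)]
      ring
    · refine (contMDiffAt_const (c := (0 : ℝ))).congr_of_eventuallyEq ?_
      filter_upwards [hzn, (isClosed_tsupport B).isOpen_compl.mem_nhds hz] with y hy hy'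
      have : B y = 0 := image_eq_zero_of_notMem_tsupport hy'
      rw [coordCoeff_smul_stdDensity _ z hy]
      simp [h, this]
  refine ⟨⟨s, hs⟩, ?_⟩
  have h1 : coordCoeff s x =ᶠ[𝓝 x] fun y ↦ q (extChartAt (𝓡 n) x y) := by
    filter_upwards [(chartAt (EuclideanSpace ℝ (Fin n)) x).open_source.mem_nhds
      (mem_chart_source _ x), B.eventuallyEq_one] with y hy hB
    have h0 : |(stdBasis n y).det (coordFrame x y)| ^ r ≠ 0 :=
      (Real.rpow_pos_of_pos (abs_pos.2 (det_coordFrame_ne_zero x hy)) r).ne'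
    rw [coordCoeff_smul_stdDensity _ x hy, Real.rpow_neg (abs_nonneg _), mul_assoc,
      mul_inv_cancel₀ h0, mul_one]
    simp [h, hB]
  have ht : Filter.Tendsto (extChartAt (𝓡 n) x).symm (𝓝 (extChartAt (𝓡 n) x x)) (𝓝 x) := by
    have := continuousAt_extChartAt_symm (I := 𝓡 n) x
    rwa [ContinuousAt, extChartAt_to_inv] at this
  filter_upwards [ht.eventually h1, extChartAt_target_mem_nhds (I := 𝓡 n) x] with z hz hz'
  simp only [inChart, Function.comp_apply]
  rw [hz, (extChartAt (𝓡 n) x).right_inv hz']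

end Existence

section ProjectiveSplitting

lemma inChart_self (f : M → ℝ) (x : M) : inChart f x (extChartAt (𝓡 n) x x) = f x := by
  simp [inChart]

variable [IsManifold (𝓡 n) ∞ M]

lemma coordCoeff_add {r : ℝ} (s t : Π y : M, Density n r y) (x : M) :
    coordCoeff (s + t) x = coordCoeff s x + coordCoeff t x := by
  funext y; simp [coordCoeff]

lemma coordCoeff_smul {r : ℝ} (c : ℝ) (s : Π y : M, Density n r y) (x : M) :
    coordCoeff (c • s) x = c • coordCoeff s x := by
  funext y; simp [coordCoeff]

lemma mdifferentiableAt_coordCoeff {r : ℝ} (s : SmoothDensity n M r) (x : M) :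
    MDifferentiableAt (𝓡 n) 𝓘(ℝ, ℝ) (coordCoeff s.1 x) x :=
  (s.2 x).mdifferentiableAt (by simp)

lemma contDiffAt_coordCoeff {r : ℝ} (s : SmoothDensity n M r) (x : M) :
    ContDiffAt ℝ ∞ (inChart (coordCoeff s.1 x) x) (extChartAt (𝓡 n) x x) :=
  contDiffAt_inChart (s.2 x)

lemma coordCoeff_self {r : ℝ} (s : Π y : M, Density n r y) (x : M) :
    coordCoeff s x x = Density.coeff (stdBasis n x) (s x) := by
  rw [coordCoeff, coordFrame_self]

/-- The map `s ↦ (∇ s (x), s (x))`. -/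
def projSplitMap (nabla : AffineConnection n M) (r : ℝ) (x : M) :
    SmoothDensity n M r →ₗ[ℝ]
      (TangentSpace (𝓡 n) x →ₗ[ℝ] Density n r x) × Density n r x where
  toFun s := (densityDeriv nabla s.1 x, s.1 x)
  map_add' s t := by
    refine Prod.ext (LinearMap.ext fun v ↦ ?_) rfl
    simp only [densityDeriv, Submodule.coe_add, coordCoeff_add,
      mvfderiv_add (mdifferentiableAt_coordCoeff s x) (mdifferentiableAt_coordCoeff t x), Prod.mk_add_mk,
      LinearMap.smulRight_apply, LinearMap.add_apply, LinearMap.smul_apply, Pi.add_apply,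
      ContinuousLinearMap.coe_coe, add_apply, smul_eq_mul, ← add_smul]
    congr 1
    ring
  map_smul' c s := by
    have h : mvfderiv (𝓡 n) (c • coordCoeff s.1 x) x = c • mvfderiv (𝓡 n) (coordCoeff s.1 x) x := by
      have := mvfderiv_smul (x := x) (I := 𝓡 n) (a := fun _ : M ↦ c) mdifferentiableAt_const
        (mdifferentiableAt_coordCoeff s x)
      rw [mvfderiv_const] at this
      ext v
      simpa using! congrArg (fun f ↦ f v) this
    refine Prod.ext (LinearMap.ext fun v ↦ ?_) rfl
    simp only [densityDeriv, Submodule.coe_smul, h, coordCoeff_smul, Prod.smul_mk,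
      LinearMap.smulRight_apply, LinearMap.add_apply, LinearMap.smul_apply, Pi.smul_apply,
      ContinuousLinearMap.coe_coe, smul_apply, smul_eq_mul, RingHom.id_apply,
      smul_smul]
    congr 1
    ring

lemma mem_jetVanish_one {r : ℝ} {x : M} {s : SmoothDensity n M r} :
    s ∈ jetVanish n r 1 x ↔ coordCoeff s.1 x x = 0 ∧
      fderiv ℝ (inChart (coordCoeff s.1 x) x) (extChartAt (𝓡 n) x x) = 0 := by
  constructor
  · intro h
    refine ⟨?_, ?_⟩
    · have := congrArg (fun f ↦ f ![]) (h 0 (by norm_num))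
      simpa [inChart] using this
    · ext v
      have := congrArg (fun f ↦ f ![v]) (h 1 le_rfl)
      simpa [iteratedFDeriv_one_apply] using this
  · rintro ⟨h0, h1⟩ j hj
    interval_cases j
    · ext m
      simpa [inChart] using h0
    · ext m
      rw [iteratedFDeriv_one_apply, h1]; rfl

lemma ker_projSplitMap (nabla : AffineConnection n M) (r : ℝ) (x : M) :
    LinearMap.ker (projSplitMap nabla r x) = jetVanish n r 1 x := by
  ext s
  rw [LinearMap.mem_ker, mem_jetVanish_one]
  have hne : stdDensity n r x ≠ 0 := fun h ↦ by
    have := stdDensity_stdBasis (n := n) r x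
    rw [h, map_zero] at this
    exact zero_ne_one this
  constructor
  · intro h
    have h1 : densityDeriv nabla s.1 x = 0 := congrArg Prod.fst h
    have h2 : s.1 x = 0 := congrArg Prod.snd h
    have h0 : coordCoeff s.1 x x = 0 := by rw [coordCoeff_self, h2, map_zero]
    refine ⟨h0, ?_⟩
    refine ContinuousLinearMap.ext fun w ↦ ?_
    let v : TangentSpace (𝓡 n) x := w
    have h3 := LinearMap.congr_fun h1 v
    simp only [densityDeriv, h0, mul_zero, zero_smul, add_zero, LinearMap.smulRight_apply,
      LinearMap.zero_apply, smul_eq_zero, hne, or_false, ContinuousLinearMap.coe_coe] at h3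
    rw [mvfderiv_eq_fderiv_inChart (mdifferentiableAt_coordCoeff s x)] at h3
    exact h3
  · rintro ⟨h0, h1⟩
    refine Prod.ext (LinearMap.ext fun v ↦ ?_) ?_
    · change densityDeriv nabla s.1 x v = 0
      simp only [densityDeriv, h0, mul_zero, zero_smul, add_zero, LinearMap.smulRight_apply,
        ContinuousLinearMap.coe_coe]
      rw [mvfderiv_eq_fderiv_inChart (mdifferentiableAt_coordCoeff s x), h1]
      exact zero_smul ℝ _
    · change s.1 x = 0
      rw [Density.eq_smul (s.1 x), ← coordCoeff_self, h0, zero_smul]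

lemma projSplitMap_surjective [T2Space M] (nabla : AffineConnection n M) (r : ℝ) (x : M) :
    Function.Surjective (projSplitMap nabla r x) := by
  rintro ⟨μ, σ⟩
  let p := extChartAt (𝓡 n) x x
  let c : ℝ := Density.coeff (stdBasis n x) σ
  let L : TangentSpace (𝓡 n) x →ₗ[ℝ] ℝ :=
    Density.coeff (stdBasis n x) ∘ₗ μ - (r * c) • connTrace nabla x
  let L' : EuclideanSpace ℝ (Fin n) →L[ℝ] ℝ :=
    LinearMap.toContinuousLinearMap (E := EuclideanSpace ℝ (Fin n)) L
  obtain ⟨s, hs⟩ := exists_smoothDensity r x (q := fun z ↦ c + L' (z - p)) (by fun_prop)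
  have h0 : coordCoeff s.1 x x = c := by
    have := hs.self_of_nhds
    rw [inChart_self] at this
    simpa [p] using this
  have h1 : fderiv ℝ (inChart (coordCoeff s.1 x) x) (extChartAt (𝓡 n) x x) = L' := by
    rw [hs.fderiv_eq]
    have : HasFDerivAt (fun z ↦ c + L' (z - p)) L' (extChartAt (𝓡 n) x x) :=
      (L'.hasFDerivAt.comp _ ((hasFDerivAt_id _).sub_const p)).const_add c
    exact this.fderiv
  refine ⟨s, Prod.ext (LinearMap.ext fun v ↦ ?_) ?_⟩
  · change densityDeriv nabla s.1 x v = μ v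
    simp only [densityDeriv, LinearMap.smulRight_apply, LinearMap.add_apply,
      ContinuousLinearMap.coe_coe, LinearMap.smul_apply, h0]
    rw [mvfderiv_eq_fderiv_inChart (mdifferentiableAt_coordCoeff s x), h1, Density.eq_smul (μ v)]
    congr 1
    change (Density.coeff (stdBasis n x) (μ v) - (r * c) • connTrace nabla x v) + _ = _
    exact sub_add_cancel _ _
  · change s.1 x = σ
    rw [Density.eq_smul (s.1 x), ← coordCoeff_self, h0, ← Density.eq_smul σ]

/-- The splitting of the 1-jet bundle determined by a connection: `j¹ₓ s ↦ (∇ s (x) ∣ s (x))`. -/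
def projSplit [T2Space M] (nabla : AffineConnection n M) (r : ℝ) (x : M) :
    Jet n r 1 x ≃ₗ[ℝ] (TangentSpace (𝓡 n) x →ₗ[ℝ] Density n r x) × Density n r x :=
  (Submodule.quotEquivOfEq _ _ (ker_projSplitMap nabla r x).symm).trans
    ((projSplitMap nabla r x).quotKerEquivOfSurjective (projSplitMap_surjective nabla r x))

end ProjectiveSplitting

section ConformalSplitting

variable [IsManifold (𝓡 n) ∞ M]

lemma mvfderiv_coordFrame {f : M → ℝ} {x y : M}
    (hy : y ∈ (chartAt (EuclideanSpace ℝ (Fin n)) x).source)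
    (hf : DifferentiableAt ℝ (inChart f x) (extChartAt (𝓡 n) x y)) (j : Fin n) :
    mvfderiv (𝓡 n) f y (coordFrame x y j) =
      fderiv ℝ (inChart f x) (extChartAt (𝓡 n) x y)
        (EuclideanSpace.basisFun (Fin n) ℝ j) := by
  have hy' : y ∈ (trivializationAt (EuclideanSpace ℝ (Fin n)) (TangentSpace (𝓡 n)) x).baseSet := by
    simpa using hy
  have hφ : HasMFDerivAt (𝓡 n) 𝓘(ℝ, EuclideanSpace ℝ (Fin n)) (extChartAt (𝓡 n) x) y
      (mfderiv (𝓡 n) 𝓘(ℝ, EuclideanSpace ℝ (Fin n)) (extChartAt (𝓡 n) x) y) :=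
    (mdifferentiableAt_extChartAt hy).hasMFDerivAt
  have hF := hf.hasFDerivAt.hasMFDerivAt
  have hc := hF.comp y hφ
  have heq : f =ᶠ[𝓝 y] inChart f x ∘ extChartAt (𝓡 n) x := by
    filter_upwards [(chartAt (EuclideanSpace ℝ (Fin n)) x).open_source.mem_nhds hy] with z hz
    simp only [inChart, Function.comp_apply]
    rw [(extChartAt (𝓡 n) x).left_inv (by simpa using hz)]
  have hm := (hc.congr_of_eventuallyEq heq).mfderiv
  have hv : mfderiv (𝓡 n) 𝓘(ℝ, EuclideanSpace ℝ (Fin n)) (extChartAt (𝓡 n) x) y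
      (coordFrame x y j) = (EuclideanSpace.basisFun (Fin n) ℝ j) := by
    rw [← TangentBundle.continuousLinearMapAt_trivializationAt hy]
    have := (trivializationAt (EuclideanSpace ℝ (Fin n))
      (TangentSpace (𝓡 n)) x).continuousLinearMapAt_symmL (R := ℝ) hy'
        (EuclideanSpace.basisFun (Fin n) ℝ j)
    refine Eq.trans ?_ this
    congr 1
  simp only [mvfderiv, hm]
  change fderiv ℝ (inChart f x) (extChartAt (𝓡 n) x y)
    (mfderiv (𝓡 n) 𝓘(ℝ, EuclideanSpace ℝ (Fin n)) (extChartAt (𝓡 n) x) y (coordFrame x y j)) = _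
  rw [hv]

lemma formDeriv_differential (nabla : AffineConnection n M) {f : M → ℝ} {x : M}
    (hf : ContMDiffAt (𝓡 n) 𝓘(ℝ, ℝ) ∞ f x) (u : TangentSpace (𝓡 n) x) (j : Fin n) :
    formDeriv nabla (fun y ↦ differential f y) x u (stdBasis n x j) =
      fderiv ℝ (fderiv ℝ (inChart f x)) (extChartAt (𝓡 n) x x) u
        (EuclideanSpace.basisFun (Fin n) ℝ j) -
      fderiv ℝ (inChart f x) (extChartAt (𝓡 n) x x) (nabla (fun y ↦ coordFrame x y j) x u) := by
  have hF := contDiffAt_inChart hf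
  have hF2 : ContDiffAt ℝ 2 (inChart f x) (extChartAt (𝓡 n) x x) :=
    contDiffAt_infty.1 hF 2
  have hF' : ContDiffAt ℝ 1 (fderiv ℝ (inChart f x)) (extChartAt (𝓡 n) x x) :=
    hF2.fderiv_right (by norm_num)
  have hev : ∀ᶠ z in 𝓝 (extChartAt (𝓡 n) x x), DifferentiableAt ℝ (inChart f x) z := by
    filter_upwards [(hF2.of_le (by norm_num : (1 : ℕ∞ω) ≤ 2)).eventually (by simp)] with z hz
    exact hz.differentiableAt (by simp)
  have hφ : ContinuousAt (extChartAt (𝓡 n) x) x := continuousAt_extChartAt x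
  let k : EuclideanSpace ℝ (Fin n) → ℝ := fun z ↦ fderiv ℝ (inChart f x) z
    (EuclideanSpace.basisFun (Fin n) ℝ j)
  have hk : ContDiffAt ℝ 1 k (extChartAt (𝓡 n) x x) := hF'.clm_apply contDiffAt_const
  have heq : (fun y ↦ differential f y (coordFrame x y j)) =ᶠ[𝓝 x] k ∘ extChartAt (𝓡 n) x := by
    filter_upwards [(chartAt (EuclideanSpace ℝ (Fin n)) x).open_source.mem_nhds
      (mem_chart_source _ x), hφ.eventually hev] with y hy hd
    exact mvfderiv_coordFrame hy hd j
  have hkM : MDifferentiableAt (𝓡 n) 𝓘(ℝ, ℝ) (k ∘ extChartAt (𝓡 n) x) x :=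
    ((hk.differentiableAt (by simp)).mdifferentiableAt).comp x
      (mdifferentiableAt_extChartAt (mem_chart_source _ x))
  have hM := hkM.congr_of_eventuallyEq heq
  have ht : Filter.Tendsto (extChartAt (𝓡 n) x).symm (𝓝 (extChartAt (𝓡 n) x x)) (𝓝 x) := by
    have := continuousAt_extChartAt_symm (I := 𝓡 n) x
    rwa [ContinuousAt, extChartAt_to_inv] at this
  have heq2 : inChart (fun y ↦ differential f y (coordFrame x y j)) x
      =ᶠ[𝓝 (extChartAt (𝓡 n) x x)] k := by
    filter_upwards [ht.eventually heq, extChartAt_target_mem_nhds (I := 𝓡 n) x] with z hz hz'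
    simp only [inChart, Function.comp_apply] at hz ⊢
    rw [hz, (extChartAt (𝓡 n) x).right_inv hz']
  rw [formDeriv, Basis.constr_basis, mvfderiv_eq_fderiv_inChart hM, heq2.fderiv_eq]
  congr 1
  · have h1 := (hF'.differentiableAt (by simp)).hasFDerivAt.clm_apply
      (hasFDerivAt_const (EuclideanSpace.basisFun (Fin n) ℝ j) (extChartAt (𝓡 n) x x))
    rw [h1.fderiv]
    simp
    rfl
  · exact mvfderiv_eq_fderiv_inChart (hf.mdifferentiableAt (by simp)) _

variable (g : PseudoMetric n M)

lemma det_gram (x : M) (v : Fin n → TangentSpace (𝓡 n) x) :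
    (gram g x v).det = ((stdBasis n x).det v) ^ 2 * (gram g x (stdBasis n x)).det := by
  have h : gram g x v = ((stdBasis n x).toMatrix v).transpose * gram g x (stdBasis n x) *
      (stdBasis n x).toMatrix v := by
    ext i j
    conv_lhs => rw [gram, Matrix.of_apply, ← (stdBasis n x).sum_toMatrix_smul_self v i,
      ← (stdBasis n x).sum_toMatrix_smul_self v j]
    simp only [map_sum, map_smul, Matrix.mul_apply, Matrix.transpose_apply, gram, Matrix.of_apply,
      FunLike.coe_sum, Finset.sum_apply, smul_apply, smul_eq_mul, Finset.sum_mul, Finset.mul_sum]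
    refine Finset.sum_congr rfl fun a _ ↦ Finset.sum_congr rfl fun b _ ↦ ?_
    ring
  rw [h, Matrix.det_mul, Matrix.det_mul, Matrix.det_transpose, Basis.det_apply]
  ring

lemma det_gram_stdBasis_ne_zero (x : M) : (gram g x (stdBasis n x)).det ≠ 0 := by
  intro h
  obtain ⟨w, hw, hw0⟩ := Matrix.exists_mulVec_eq_zero_iff.2 h
  have hu : ∑ i, w i • stdBasis n x i = 0 := by
    refine g.nondegenerate x _ fun v ↦ ?_
    have h2 : ∀ j, g.val x (stdBasis n x j) (∑ i, w i • stdBasis n x i) = 0 := fun j ↦ by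
      have := congrFun hw0 j
      simp only [Matrix.mulVec, dotProduct, gram, Matrix.of_apply, Pi.zero_apply] at this
      rw [map_sum, ← this]
      refine Finset.sum_congr rfl fun i _ ↦ ?_
      rw [map_smul, smul_eq_mul, mul_comm]
    generalize ∑ i, w i • stdBasis n x i = u at h2 ⊢
    rw [g.symm, ← (stdBasis n x).sum_repr v]
    simp only [map_sum, map_smul, FunLike.coe_sum, Finset.sum_apply, smul_apply, h2, smul_zero,
      Finset.sum_const_zero]
  exact hw (funext (Fintype.linearIndependent_iff.1 (stdBasis n x).linearIndependent w hu))

/-- The factor relating the trivialisation by `g` to the coordinate frame at `x`. -/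
def volFactor (r : ℝ) (x : M) (y : M) : ℝ := |(gram g y (coordFrame x y)).det| ^ (r / 2)

lemma volFactor_self_pos (r : ℝ) (x : M) : 0 < volFactor g r x x := by
  rw [volFactor, coordFrame_self]
  exact Real.rpow_pos_of_pos (abs_pos.2 (det_gram_stdBasis_ne_zero g x)) _

lemma contMDiffAt_volFactor (r : ℝ) (x : M) :
    ContMDiffAt (𝓡 n) 𝓘(ℝ, ℝ) ∞ (volFactor g r x) x := by
  refine contMDiffAt_abs_rpow (contMDiffAt_det fun i j ↦ ?_) ?_ _
  · have h := ContMDiffAt.clm_bundle_apply₂ (F₃ := ℝ) (E₃ := fun _ : M ↦ ℝ) (b := fun y : M ↦ y)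
      (g.contMDiff x)
      (contMDiffAt_coordField x (stdBasis n x i) (mem_chart_source _ x))
      (contMDiffAt_coordField x (stdBasis n x j) (mem_chart_source _ x))
    rw [contMDiffAt_totalSpace] at h
    exact h.2
  · change (gram g x (coordFrame x x)).det ≠ 0
    rw [coordFrame_self]
    exact det_gram_stdBasis_ne_zero g x

lemma scale_eq {r : ℝ} (s : Π y : M, Density n r y) (x : M) {y : M}
    (hy : y ∈ (chartAt (EuclideanSpace ℝ (Fin n)) x).source) :
    scale g r y (s y) = volFactor g r x y * coordCoeff s x y := by
  have hd := det_coordFrame_ne_zero x hy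
  have h0 : |(stdBasis n y).det (coordFrame x y)| ^ r ≠ 0 :=
    (Real.rpow_pos_of_pos (abs_pos.2 hd) r).ne'
  have h1 : (((stdBasis n y).det (coordFrame x y)) ^ 2) ^ (r / 2) =
      |(stdBasis n y).det (coordFrame x y)| ^ r := by
    rw [← sq_abs, ← Real.rpow_natCast, ← Real.rpow_mul (abs_nonneg _)]
    congr 1
    push_cast; ring
  rw [coordCoeff, Density.apply_eq (s y) hd, volFactor, det_gram, abs_mul,
    Real.mul_rpow (abs_nonneg _) (abs_nonneg _), abs_sq, h1, Real.rpow_neg (abs_nonneg _)]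
  field_simp
  rfl

/-- A section of the density bundle, as a function in the trivialisation by `g`. -/
def scaled {r : ℝ} (s : Π y : M, Density n r y) (y : M) : ℝ := scale g r y (s y)

lemma contMDiffAt_scaled {r : ℝ} (s : SmoothDensity n M r) (x : M) :
    ContMDiffAt (𝓡 n) 𝓘(ℝ, ℝ) ∞ (scaled g s.1) x := by
  refine ((contMDiffAt_volFactor g r x).mul (s.2 x)).congr_of_eventuallyEq ?_
  filter_upwards [(chartAt (EuclideanSpace ℝ (Fin n)) x).open_source.mem_nhds
    (mem_chart_source _ x)] with y hy
  exact scale_eq g s.1 x hy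

lemma inChart_scaled {r : ℝ} (s : SmoothDensity n M r) (x : M) :
    inChart (scaled g s.1) x =ᶠ[𝓝 (extChartAt (𝓡 n) x x)]
      fun z ↦ inChart (volFactor g r x) x z * inChart (coordCoeff s.1 x) x z := by
  filter_upwards [extChartAt_target_mem_nhds (I := 𝓡 n) x] with z hz
  exact scale_eq g s.1 x (by simpa using (extChartAt (𝓡 n) x).map_target hz)

end ConformalSplitting

section ConformalCotractors

variable [IsManifold (𝓡 n) ∞ M] (g : PseudoMetric n M) (nabla : AffineConnection n M)

/-- The metric trace of the matrix of second coordinate derivatives at `x` of a density. On the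
densities with vanishing 1-jet at `x` this matrix is the 2-jet, a symmetric 2-tensor. -/
def hessTrace (r : ℝ) (x : M) : SmoothDensity n M r →ₗ[ℝ] ℝ where
  toFun s := ∑ i, ∑ j, gInv g x i j *
    iteratedFDeriv ℝ 2 (inChart (coordCoeff s.1 x) x) (extChartAt (𝓡 n) x x)
      ![EuclideanSpace.basisFun (Fin n) ℝ i, EuclideanSpace.basisFun (Fin n) ℝ j]
  map_add' s t := by
    have := iteratedFDeriv_add_apply (i := 2) (𝕜 := ℝ)
      (contDiffAt_infty.1 (contDiffAt_inChart (s.2 x)) 2)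
      (contDiffAt_infty.1 (contDiffAt_inChart (t.2 x)) 2)
    have h : iteratedFDeriv ℝ 2 (inChart (coordCoeff (s + t).1 x) x) (extChartAt (𝓡 n) x x) =
      iteratedFDeriv ℝ 2 (inChart (coordCoeff s.1 x) x) (extChartAt (𝓡 n) x x) +
      iteratedFDeriv ℝ 2 (inChart (coordCoeff t.1 x) x) (extChartAt (𝓡 n) x x) := this
    simp only [h, add_apply, mul_add, Finset.sum_add_distrib]
  map_smul' c s := by
    have := iteratedFDeriv_const_smul_apply (i := 2) (𝕜 := ℝ) (a := c)
      (contDiffAt_infty.1 (contDiffAt_inChart (s.2 x)) 2)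
    have h : iteratedFDeriv ℝ 2 (inChart (coordCoeff (c • s).1 x) x) (extChartAt (𝓡 n) x x) =
      c • iteratedFDeriv ℝ 2 (inChart (coordCoeff s.1 x) x) (extChartAt (𝓡 n) x x) := this
    simp only [h, smul_apply, Finset.mul_sum, RingHom.id_apply,
      smul_eq_mul, mul_left_comm]

/-- The smooth densities whose 1-jet at `x` vanishes and whose 2-jet there is trace-free. -/
def traceFreeSections (r : ℝ) (x : M) : Submodule ℝ (SmoothDensity n M r) :=
  jetVanish n r 1 x ⊓ LinearMap.ker (hessTrace g r x)

/-- The trace-free symmetric 2-tensors in the bundle of 2-jets of densities, that is, the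
trace-free part of the kernel of `J² → J¹`. It depends only on the conformal class of `g`. -/
def traceFree (r : ℝ) (x : M) : Submodule ℝ (Jet n r 2 x) :=
  (traceFreeSections g r x).map (jetVanish n r 2 x).mkQ

/-- The fibre at `x` of the conformal cotractor bundle, the quotient of the bundle of 2-jets of
densities of conformal weight `1` by the trace-free part of the kernel of `J² → J¹`. -/
abbrev ConfCotractor (x : M) : Type _ :=
  Jet n ((1 : ℝ) / n) 2 x ⧸ traceFree g ((1 : ℝ) / n) x

lemma jetVanish_two_le (r : ℝ) (x : M) : jetVanish n r 2 x ≤ traceFreeSections g r x := by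
  intro s hs
  refine ⟨fun j hj ↦ hs j (hj.trans (by norm_num)), ?_⟩
  rw [SetLike.mem_coe, LinearMap.mem_ker]
  simp only [hessTrace, LinearMap.coe_mk, AddHom.coe_mk, hs 2 le_rfl]
  simp

lemma scaled_self {r : ℝ} (s : SmoothDensity n M r) (x : M) :
    scaled g s.1 x = volFactor g r x x * coordCoeff s.1 x x :=
  scale_eq g s.1 x (mem_chart_source _ x)

lemma contDiffAt_inChart_volFactor (r : ℝ) (x : M) :
    ContDiffAt ℝ ∞ (inChart (volFactor g r x) x) (extChartAt (𝓡 n) x x) :=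
  contDiffAt_inChart (contMDiffAt_volFactor g r x)

lemma fderiv_scaled {r : ℝ} (s : SmoothDensity n M r) (x : M) :
    fderiv ℝ (inChart (scaled g s.1) x) (extChartAt (𝓡 n) x x) =
      volFactor g r x x • fderiv ℝ (inChart (coordCoeff s.1 x) x) (extChartAt (𝓡 n) x x) +
      coordCoeff s.1 x x • fderiv ℝ (inChart (volFactor g r x) x) (extChartAt (𝓡 n) x x) := by
  rw [(inChart_scaled g s x).fderiv_eq]
  have h := ((contDiffAt_inChart_volFactor g r x).differentiableAt (by simp)).hasFDerivAt.mul
    ((contDiffAt_coordCoeff s x).differentiableAt (by simp)).hasFDerivAt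
  rw [inChart_self, inChart_self] at h
  exact h.fderiv

lemma fderiv_fderiv_scaled {r : ℝ} (s : SmoothDensity n M r) (x : M)
    (hs : s ∈ jetVanish n r 1 x) (u v : EuclideanSpace ℝ (Fin n)) :
    fderiv ℝ (fderiv ℝ (inChart (scaled g s.1) x)) (extChartAt (𝓡 n) x x) u v =
      volFactor g r x x *
        fderiv ℝ (fderiv ℝ (inChart (coordCoeff s.1 x) x)) (extChartAt (𝓡 n) x x) u v := by
  obtain ⟨h0, h1⟩ := mem_jetVanish_one.1 hs
  have hV := contDiffAt_infty.1 (contDiffAt_inChart_volFactor g r x) 2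
  have hG := contDiffAt_infty.1 (contDiffAt_coordCoeff s x) 2
  have hV' : ContDiffAt ℝ 1 (fderiv ℝ (inChart (volFactor g r x) x)) (extChartAt (𝓡 n) x x) :=
    hV.fderiv_right (by norm_num)
  have hG' : ContDiffAt ℝ 1 (fderiv ℝ (inChart (coordCoeff s.1 x) x)) (extChartAt (𝓡 n) x x) :=
    hG.fderiv_right (by norm_num)
  have heq : fderiv ℝ (inChart (scaled g s.1) x) =ᶠ[𝓝 (extChartAt (𝓡 n) x x)] fun z ↦
      inChart (volFactor g r x) x z • fderiv ℝ (inChart (coordCoeff s.1 x) x) z +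
      inChart (coordCoeff s.1 x) x z • fderiv ℝ (inChart (volFactor g r x) x) z := by
    filter_upwards [(inChart_scaled g s x).fderiv (𝕜 := ℝ), hV.eventually (by simp),
      hG.eventually (by simp)] with z hz hzV hzG
    rw [hz]
    exact ((hzV.differentiableAt (by simp)).hasFDerivAt.mul
      (hzG.differentiableAt (by simp)).hasFDerivAt).fderiv
  rw [heq.fderiv_eq]
  have hA := (hV.differentiableAt (by simp)).hasFDerivAt.smul
    (hG'.differentiableAt (by simp)).hasFDerivAt
  have hB := (hG.differentiableAt (by simp)).hasFDerivAt.smul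
    (hV'.differentiableAt (by simp)).hasFDerivAt
  have hAB := (hA.add hB).fderiv
  rw [inChart_self, inChart_self, h0, h1] at hAB
  refine (congrArg (fun T ↦ T u v) hAB).trans ?_
  simp

/-- The map `s ↦ (-(1/n) (Δ s + J̃ s), ∇ s, s)` at `x`, with `s` read in the trivialisation
by `g`. -/
def confSplitMap (r : ℝ) (x : M) :
    SmoothDensity n M r →ₗ[ℝ] ℝ × (TangentSpace (𝓡 n) x →ₗ[ℝ] ℝ) × ℝ where
  toFun s := (-(1 / (n : ℝ)) * (laplacian g nabla (scaled g s.1) x +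
      confJ g nabla x * scaled g s.1 x), differential (n := n) (scaled g s.1) x, scaled g s.1 x)
  map_add' s t := by
    have h0 : scaled g (s + t).1 = scaled g s.1 + scaled g t.1 := by
      funext y; exact map_add _ _ _
    have hs := contMDiffAt_scaled g s x
    have ht := contMDiffAt_scaled g t x
    have hst : ContMDiffAt (𝓡 n) 𝓘(ℝ, ℝ) ∞ (scaled g s.1 + scaled g t.1) x := hs.add ht
    have h1 : differential (n := n) (scaled g s.1 + scaled g t.1) x =
        differential (n := n) (scaled g s.1) x + differential (n := n) (scaled g t.1) x := by
      rw [differential, mvfderiv_add (hs.mdifferentiableAt (by simp))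
        (ht.mdifferentiableAt (by simp))]
      rfl
    have hcs := contDiffAt_infty.1 (contDiffAt_inChart hs) 2
    have hct := contDiffAt_infty.1 (contDiffAt_inChart ht) 2
    have h2 : fderiv ℝ (inChart (scaled g s.1 + scaled g t.1) x)
        =ᶠ[𝓝 (extChartAt (𝓡 n) x x)]
        fderiv ℝ (inChart (scaled g s.1) x) + fderiv ℝ (inChart (scaled g t.1) x) := by
      filter_upwards [hcs.eventually (by simp), hct.eventually (by simp)] with z hz hz'
      exact fderiv_add (hz.differentiableAt (by simp)) (hz'.differentiableAt (by simp))
    have h3 : fderiv ℝ (fderiv ℝ (inChart (scaled g s.1 + scaled g t.1) x))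
        (extChartAt (𝓡 n) x x) =
        fderiv ℝ (fderiv ℝ (inChart (scaled g s.1) x)) (extChartAt (𝓡 n) x x) +
        fderiv ℝ (fderiv ℝ (inChart (scaled g t.1) x)) (extChartAt (𝓡 n) x x) := by
      rw [h2.fderiv_eq]
      exact fderiv_add
        ((hcs.fderiv_right (m := 1) (by norm_num)).differentiableAt (by simp))
        ((hct.fderiv_right (m := 1) (by norm_num)).differentiableAt (by simp))
    have h3' : ∀ u v : EuclideanSpace ℝ (Fin n),
        fderiv ℝ (fderiv ℝ (inChart (scaled g s.1 + scaled g t.1) x)) (extChartAt (𝓡 n) x x) u v =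
        fderiv ℝ (fderiv ℝ (inChart (scaled g s.1) x)) (extChartAt (𝓡 n) x x) u v +
        fderiv ℝ (fderiv ℝ (inChart (scaled g t.1) x)) (extChartAt (𝓡 n) x x) u v := by
      intro u v; rw [h3]; rfl
    have h2' : ∀ u : EuclideanSpace ℝ (Fin n),
        fderiv ℝ (inChart (scaled g s.1 + scaled g t.1) x) (extChartAt (𝓡 n) x x) u =
        fderiv ℝ (inChart (scaled g s.1) x) (extChartAt (𝓡 n) x x) u +
        fderiv ℝ (inChart (scaled g t.1) x) (extChartAt (𝓡 n) x x) u := by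
      intro u; rw [h2.self_of_nhds]; rfl
    have h4 : laplacian g nabla (scaled g s.1 + scaled g t.1) x =
        laplacian g nabla (scaled g s.1) x + laplacian g nabla (scaled g t.1) x := by
      simp only [laplacian, metricTrace, ← Finset.sum_add_distrib]
      refine Finset.sum_congr rfl fun i _ ↦ Finset.sum_congr rfl fun j _ ↦ ?_
      rw [formDeriv_differential nabla hs, formDeriv_differential nabla ht,
        formDeriv_differential nabla hst]
      have e1 := h3' (stdBasis n x i) (EuclideanSpace.basisFun (Fin n) ℝ j)
      have e2 := h2' (nabla (fun y ↦ coordFrame x y j) x (stdBasis n x i))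
      linear_combination gInv g x i j * (e1 - e2)
    rw [h0, h4, h1]
    refine Prod.ext ?_ rfl
    simp only [Pi.add_apply, Prod.fst_add]
    ring
  map_smul' c s := by
    have h0 : scaled g (c • s).1 = c • scaled g s.1 := by
      funext y; exact map_smul (scale g r y) c (s.1 y)
    have hs := contMDiffAt_scaled g s x
    have hst : ContMDiffAt (𝓡 n) 𝓘(ℝ, ℝ) ∞ (c • scaled g s.1) x :=
      (contMDiffAt_const (c := c)).mul hs
    have h1 : differential (n := n) (c • scaled g s.1) x = c • differential (n := n) (scaled g s.1) x := by
      have := mvfderiv_smul (x := x) (I := 𝓡 n) (a := fun _ : M ↦ c) mdifferentiableAt_const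
        (hs.mdifferentiableAt (by simp))
      rw [mvfderiv_const] at this
      ext v
      simpa [differential] using! congrArg (fun f ↦ f v) this
    have hcs := contDiffAt_infty.1 (contDiffAt_inChart hs) 2
    have h2 : fderiv ℝ (inChart (c • scaled g s.1) x)
        =ᶠ[𝓝 (extChartAt (𝓡 n) x x)] c • fderiv ℝ (inChart (scaled g s.1) x) := by
      filter_upwards [hcs.eventually (by simp)] with z hz
      exact fderiv_const_smul (hz.differentiableAt (by simp)) c
    have h3 : fderiv ℝ (fderiv ℝ (inChart (c • scaled g s.1) x)) (extChartAt (𝓡 n) x x) =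
        c • fderiv ℝ (fderiv ℝ (inChart (scaled g s.1) x)) (extChartAt (𝓡 n) x x) := by
      rw [h2.fderiv_eq]
      exact fderiv_const_smul
        ((hcs.fderiv_right (m := 1) (by norm_num)).differentiableAt (by simp)) c
    have h3' : ∀ u v : EuclideanSpace ℝ (Fin n),
        fderiv ℝ (fderiv ℝ (inChart (c • scaled g s.1) x)) (extChartAt (𝓡 n) x x) u v =
        c * fderiv ℝ (fderiv ℝ (inChart (scaled g s.1) x)) (extChartAt (𝓡 n) x x) u v := by
      intro u v; rw [h3]; rfl
    have h2' : ∀ u : EuclideanSpace ℝ (Fin n),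
        fderiv ℝ (inChart (c • scaled g s.1) x) (extChartAt (𝓡 n) x x) u =
        c * fderiv ℝ (inChart (scaled g s.1) x) (extChartAt (𝓡 n) x x) u := by
      intro u; rw [h2.self_of_nhds]; rfl
    have h4 : laplacian g nabla (c • scaled g s.1) x = c * laplacian g nabla (scaled g s.1) x := by
      simp only [laplacian, metricTrace, Finset.mul_sum]
      refine Finset.sum_congr rfl fun i _ ↦ Finset.sum_congr rfl fun j _ ↦ ?_
      rw [formDeriv_differential nabla hs, formDeriv_differential nabla hst]
      have e1 := h3' (stdBasis n x i) (EuclideanSpace.basisFun (Fin n) ℝ j)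
      have e2 := h2' (nabla (fun y ↦ coordFrame x y j) x (stdBasis n x i))
      linear_combination gInv g x i j * (e1 - e2)
    rw [h0, h4, h1]
    refine Prod.ext ?_ rfl
    simp only [Pi.smul_apply, Prod.smul_fst, smul_eq_mul, RingHom.id_apply]
    ring

lemma laplacian_scaled {r : ℝ} (s : SmoothDensity n M r) (x : M) (hs : s ∈ jetVanish n r 1 x) :
    laplacian g nabla (scaled g s.1) x = volFactor g r x x * hessTrace g r x s := by
  have hd : fderiv ℝ (inChart (scaled g s.1) x) (extChartAt (𝓡 n) x x) = 0 := by
    obtain ⟨h0, h1⟩ := mem_jetVanish_one.1 hs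
    rw [fderiv_scaled, h0, h1, smul_zero, zero_smul, add_zero]
  simp only [laplacian, metricTrace, hessTrace, LinearMap.coe_mk, AddHom.coe_mk, Finset.mul_sum]
  refine Finset.sum_congr rfl fun i _ ↦ Finset.sum_congr rfl fun j _ ↦ ?_
  rw [formDeriv_differential nabla (contMDiffAt_scaled g s x), hd, iteratedFDeriv_two_apply]
  have h2 := fderiv_fderiv_scaled g s x hs (EuclideanSpace.basisFun (Fin n) ℝ i)
    (EuclideanSpace.basisFun (Fin n) ℝ j)
  have h3 : stdBasis n x i = EuclideanSpace.basisFun (Fin n) ℝ i :=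
    congrFun (EuclideanSpace.basisFun (Fin n) ℝ).coe_toBasis i
  rw [h3]
  simp only [Matrix.cons_val_zero, Matrix.cons_val_one]
  change gInv g x i j * (fderiv ℝ (fderiv ℝ (inChart (scaled g s.1) x)) (extChartAt (𝓡 n) x x)
    _ _ - 0) = _
  rw [sub_zero, h2]
  ring

lemma differential_eq {f : M → ℝ} {x : M} (hf : ContMDiffAt (𝓡 n) 𝓘(ℝ, ℝ) ∞ f x)
    (v : TangentSpace (𝓡 n) x) :
    differential f x v = fderiv ℝ (inChart f x) (extChartAt (𝓡 n) x x) v :=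
  mvfderiv_eq_fderiv_inChart (hf.mdifferentiableAt (by simp)) v

lemma ker_confSplitMap [NeZero n] (r : ℝ) (x : M) :
    LinearMap.ker (confSplitMap g nabla r x) = traceFreeSections g r x := by
  have hV := (volFactor_self_pos g r x).ne'
  have hn : (n : ℝ) ≠ 0 := Nat.cast_ne_zero.2 (NeZero.ne n)
  ext s
  rw [LinearMap.mem_ker]
  constructor
  · intro h
    have h3 : scaled g s.1 x = 0 := congrArg (fun p ↦ p.2.2) h
    have h2 : differential (n := n) (scaled g s.1) x = 0 := congrArg (fun p ↦ p.2.1) h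
    have h1 : -(1 / (n : ℝ)) * (laplacian g nabla (scaled g s.1) x +
      confJ g nabla x * scaled g s.1 x) = 0 := congrArg (fun p ↦ p.1) h
    have h0 : coordCoeff s.1 x x = 0 := by
      rw [scaled_self] at h3
      exact (mul_eq_zero.1 h3).resolve_left hV
    have hd : fderiv ℝ (inChart (coordCoeff s.1 x) x) (extChartAt (𝓡 n) x x) = 0 := by
      have h4 : fderiv ℝ (inChart (scaled g s.1) x) (extChartAt (𝓡 n) x x) = 0 := by
        refine ContinuousLinearMap.ext fun v ↦ ?_
        exact (differential_eq (contMDiffAt_scaled g s x) v).symm.trans (by rw [h2]; rfl)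
      rw [fderiv_scaled, h0, zero_smul, add_zero] at h4
      exact (smul_eq_zero.1 h4).resolve_left hV
    have hs : s ∈ jetVanish n r 1 x := mem_jetVanish_one.2 ⟨h0, hd⟩
    refine ⟨hs, ?_⟩
    rw [SetLike.mem_coe, LinearMap.mem_ker]
    rw [h3, mul_zero, add_zero, laplacian_scaled g nabla s x hs] at h1
    simpa [hn, hV] using h1
  · rintro ⟨hs, ht⟩
    rw [SetLike.mem_coe, LinearMap.mem_ker] at ht
    obtain ⟨h0, h1⟩ := mem_jetVanish_one.1 hs
    have h3 : scaled g s.1 x = 0 := by rw [scaled_self, h0, mul_zero]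
    refine Prod.ext ?_ (Prod.ext (LinearMap.ext fun v ↦ ?_) h3)
    · change -(1 / (n : ℝ)) * (laplacian g nabla (scaled g s.1) x +
        confJ g nabla x * scaled g s.1 x) = 0
      rw [laplacian_scaled g nabla s x hs, ht, h3]
      simp
    · refine (differential_eq (contMDiffAt_scaled g s x) v).trans ?_
      rw [fderiv_scaled, h0, h1, smul_zero, zero_smul, add_zero]
      rfl

lemma sum_gInv_mul (x : M) :
    ∑ i, ∑ j, gInv g x i j * g.val x (stdBasis n x i) (stdBasis n x j) = n := by
  have h : gInv g x * gram g x (stdBasis n x) = 1 :=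
    Matrix.nonsing_inv_mul _ (isUnit_iff_ne_zero.2 (det_gram_stdBasis_ne_zero g x))
  have h2 := congrArg Matrix.trace h
  rw [Matrix.trace_one, Fintype.card_fin] at h2
  rw [← h2]
  simp only [Matrix.trace, Matrix.diag_apply, Matrix.mul_apply, gram, Matrix.of_apply]
  refine Finset.sum_congr rfl fun i _ ↦ Finset.sum_congr rfl fun j _ ↦ ?_
  rw [g.symm]

lemma confSplitMap_surjective [NeZero n] [T2Space M] (r : ℝ) (x : M) :
    Function.Surjective (confSplitMap g nabla r x) := by
  have hV := (volFactor_self_pos g r x).ne'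
  have hn : (n : ℝ) ≠ 0 := Nat.cast_ne_zero.2 (NeZero.ne n)
  set p := extChartAt (𝓡 n) x x with hp
  -- densities with vanishing 1-jet reach the first slot
  have hquad : ∃ s, confSplitMap g nabla r x s = (1, 0, 0) := by
    let b : EuclideanSpace ℝ (Fin n) →L[ℝ] EuclideanSpace ℝ (Fin n) →L[ℝ] ℝ := g.val x
    have hb : ∀ u v, b u v = b v u := fun u v ↦ g.symm x u v
    let a : ℝ := -1 / volFactor g r x x
    obtain ⟨s, hs⟩ := exists_smoothDensity r x (q := fun z ↦ a / 2 * b (z - p) (z - p))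
      (by fun_prop)
    have hq1 : ∀ z, HasFDerivAt (fun z ↦ a / 2 * b (z - p) (z - p)) (a • b (z - p)) z := by
      intro z
      have hz : HasFDerivAt (fun z : EuclideanSpace ℝ (Fin n) ↦ z - p)
        (ContinuousLinearMap.id ℝ _) z := (hasFDerivAt_id z).sub_const p
      have h := ((b.hasFDerivAt.comp z hz).clm_apply hz).const_mul (a / 2)
      refine h.congr_fderiv ?_
      ext v
      have h1 := hb v z
      have h2 := hb v p
      simp
      linear_combination a / 2 * (h1 - h2)
    have hq2 : fderiv ℝ (fun z ↦ a / 2 * b (z - p) (z - p)) = fun z ↦ a • b (z - p) :=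
      funext fun z ↦ (hq1 z).fderiv
    have hd : fderiv ℝ (inChart (coordCoeff s.1 x) x) =ᶠ[𝓝 p] fun z ↦ a • b (z - p) := by
      rw [← hq2]; exact hs.fderiv (𝕜 := ℝ)
    have hd2 : fderiv ℝ (fderiv ℝ (inChart (coordCoeff s.1 x) x)) p = a • b := by
      rw [hd.fderiv_eq]
      have hz : HasFDerivAt (fun z : EuclideanSpace ℝ (Fin n) ↦ z - p)
        (ContinuousLinearMap.id ℝ _) p := (hasFDerivAt_id p).sub_const p
      exact ((b.hasFDerivAt.comp p hz).const_smul a).fderiv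
    have h0 : coordCoeff s.1 x x = 0 := by
      have := hs.self_of_nhds
      rw [inChart_self] at this
      simpa [p] using this
    have hjet : s ∈ jetVanish n r 1 x :=
      mem_jetVanish_one.2 ⟨h0, by rw [← hp, hd.self_of_nhds]; simp⟩
    have htr : hessTrace g r x s = a * n := by
      rw [← sum_gInv_mul g x]
      simp only [hessTrace, LinearMap.coe_mk, AddHom.coe_mk, Finset.mul_sum]
      refine Finset.sum_congr rfl fun i _ ↦ Finset.sum_congr rfl fun j _ ↦ ?_
      rw [iteratedFDeriv_two_apply, ← hp, hd2]
      have h3 : ∀ i, stdBasis n x i = EuclideanSpace.basisFun (Fin n) ℝ i :=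
        congrFun (EuclideanSpace.basisFun (Fin n) ℝ).coe_toBasis
      simp only [Matrix.cons_val_zero, Matrix.cons_val_one, h3]
      change gInv g x i j * (a * b _ _) = a * (gInv g x i j * b _ _)
      ring
    have h3 : scaled g s.1 x = 0 := by rw [scaled_self, h0, mul_zero]
    refine ⟨s, Prod.ext ?_ (Prod.ext (LinearMap.ext fun v ↦ ?_) h3)⟩
    · change -(1 / (n : ℝ)) * (laplacian g nabla (scaled g s.1) x +
        confJ g nabla x * scaled g s.1 x) = 1
      rw [laplacian_scaled g nabla s x hjet, htr, h3]
      simp only [a]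
      field_simp
      simp
    · refine (differential_eq (contMDiffAt_scaled g s x) v).trans ?_
      rw [fderiv_scaled, h0, (mem_jetVanish_one.1 hjet).2, smul_zero, zero_smul, add_zero]
      rfl
  -- affine functions in the chart reach the last two slots
  have haff : ∀ (m : TangentSpace (𝓡 n) x →ₗ[ℝ] ℝ) (c : ℝ),
      ∃ s, (confSplitMap g nabla r x s).2 = (m, c) := by
    intro m c
    let V0 := volFactor g r x x
    let m' : EuclideanSpace ℝ (Fin n) →L[ℝ] ℝ :=
      LinearMap.toContinuousLinearMap (E := EuclideanSpace ℝ (Fin n)) m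
    let L : EuclideanSpace ℝ (Fin n) →L[ℝ] ℝ :=
      V0⁻¹ • (m' - (c / V0) • fderiv ℝ (inChart (volFactor g r x) x) p)
    obtain ⟨s, hs⟩ := exists_smoothDensity r x (q := fun z ↦ c / V0 + L (z - p)) (by fun_prop)
    have h0 : coordCoeff s.1 x x = c / V0 := by
      have := hs.self_of_nhds
      rw [inChart_self] at this
      simpa [p] using this
    have h1 : fderiv ℝ (inChart (coordCoeff s.1 x) x) p = L := by
      rw [hs.fderiv_eq]
      have : HasFDerivAt (fun z ↦ c / V0 + L (z - p)) L p :=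
        (L.hasFDerivAt.comp _ ((hasFDerivAt_id _).sub_const p)).const_add (c / V0)
      exact this.fderiv
    refine ⟨s, Prod.ext (LinearMap.ext fun v ↦ ?_) ?_⟩
    · refine (differential_eq (contMDiffAt_scaled g s x) v).trans ?_
      rw [fderiv_scaled, ← hp, h0, h1]
      simp only [L]
      rw [smul_inv_smul₀ hV, sub_add_cancel]
      rfl
    · change scaled g s.1 x = c
      rw [scaled_self, h0]
      exact mul_div_cancel₀ c hV
  rintro ⟨t, m, c⟩
  obtain ⟨s1, hs1⟩ := hquad
  obtain ⟨s2, hs2⟩ := haff m c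
  refine ⟨(t - (confSplitMap g nabla r x s2).1) • s1 + s2, ?_⟩
  rw [map_add, map_smul, hs1]
  refine Prod.ext ?_ ?_
  · simp
  · simp [hs2]

/-- The splitting of the conformal cotractor bundle determined by the metric `g` (with Levi-Civita
connection `∇`), in the trivialisation of the density bundles by `g`:
`j²ₓ s ↦ (-(1/n) (Δ s + J̃ s) ∣ ∇ s ∣ s)`. -/
def confSplit [NeZero n] [T2Space M] (x : M) :
    ConfCotractor g x ≃ₗ[ℝ] ℝ × (TangentSpace (𝓡 n) x →ₗ[ℝ] ℝ) × ℝ :=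
  ((Submodule.quotientQuotientEquivQuotient _ _ (jetVanish_two_le g ((1 : ℝ) / n) x)).trans
    (Submodule.quotEquivOfEq _ _ (ker_confSplitMap g nabla ((1 : ℝ) / n) x).symm)).trans
    ((confSplitMap g nabla ((1 : ℝ) / n) x).quotKerEquivOfSurjective
      (confSplitMap_surjective g nabla ((1 : ℝ) / n) x))

end ConformalCotractors

section ProjectiveTractors

variable [IsManifold (𝓡 n) ∞ M]

/-- The fibre at `x` of the projective cotractor bundle `𝓔_A = J¹ 𝓔(1)`, where `𝓔(1)` is the
positive `(2n+2)`-th root of `(Λⁿ TM)²`. -/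
abbrev ProjCotractor (n : ℕ) {M : Type*} [TopologicalSpace M]
    [ChartedSpace (EuclideanSpace ℝ (Fin n)) M] [IsManifold (𝓡 n) ∞ M] (x : M) : Type _ :=
  Jet n ((1 : ℝ) / (n + 1)) 1 x

/-- The projection `j¹ₓ s ↦ s x` of the 1-jets. Its kernel is the bundle of density-valued
1-forms. -/
def jetEval (r : ℝ) (x : M) : Jet n r 1 x →ₗ[ℝ] Density n r x :=
  (jetVanish n r 1 x).liftQ (LinearMap.proj x ∘ₗ (SmoothDensity n M r).subtype) fun s hs ↦ by
    have h0 := (mem_jetVanish_one.1 hs).1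
    rw [coordCoeff_self] at h0
    rw [LinearMap.mem_ker]
    change s.1 x = 0
    rw [Density.eq_smul (s.1 x), h0, zero_smul]

variable [T2Space M] (g : PseudoMetric n M) (nabla : AffineConnection n M)

/-- The first slot `μ` of a projective cotractor `(μ ∣ σ)` in the splitting by `∇`. -/
def projMu (x : M) :
    ProjCotractor n x →ₗ[ℝ] (TangentSpace (𝓡 n) x →ₗ[ℝ] Density n ((1 : ℝ) / (n + 1)) x) :=
  LinearMap.fst ℝ _ _ ∘ₗ (projSplit nabla ((1 : ℝ) / (n + 1)) x).toLinearMap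

/-- The second slot `σ` of a projective cotractor `(μ ∣ σ)` in the splitting by `∇`. -/
def projSigma (x : M) : ProjCotractor n x →ₗ[ℝ] Density n ((1 : ℝ) / (n + 1)) x :=
  LinearMap.snd ℝ _ _ ∘ₗ (projSplit nabla ((1 : ℝ) / (n + 1)) x).toLinearMap

/-- Smoothness of a section of the projective cotractor bundle. -/
def IsSmoothProj (U : Π x : M, ProjCotractor n x) : Prop :=
  ∀ x : M, ContMDiffAt (𝓡 n) 𝓘(ℝ, ℝ) ∞ (coordCoeff (fun y ↦ projSigma nabla y (U y)) x) x ∧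
    ∀ i, ContMDiffAt (𝓡 n) 𝓘(ℝ, ℝ) ∞
      (coordCoeff (fun y ↦ projMu nabla y (U y) (coordFrame x y i)) x) x

/-- The projective cotractor connection:
`∇_X (μ ∣ σ) = (∇_X μ + P(X, ·) σ ∣ ∇_X σ - μ(X))` in the splitting by `∇`. -/
def projTractorConn (U : Π x : M, ProjCotractor n x) (x : M) (X : TangentSpace (𝓡 n) x) :
    ProjCotractor n x :=
  (projSplit nabla ((1 : ℝ) / (n + 1)) x).symm
    (densityFormDeriv nabla (fun y ↦ projMu nabla y (U y)) x X +
      (stdBasis n x).constr ℝ (fun i ↦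
        projSchouten nabla x X (stdBasis n x i) • projSigma nabla x (U x)),
    densityDeriv nabla (fun y ↦ projSigma nabla y (U y)) x X - projMu nabla x (U x) X)

/-- A field `h` of bilinear forms on the projective cotractor bundle is a sub-metric: it is
smooth, symmetric, and nondegenerate on the kernel of `J¹ 𝓔(1) → 𝓔(1)`. -/
structure IsSubMetric (h : Π x : M, LinearMap.BilinForm ℝ (ProjCotractor n x)) : Prop where
  smooth (U U' : Π x : M, ProjCotractor n x) (hU : IsSmoothProj nabla U)
    (hU' : IsSmoothProj nabla U') :
    ContMDiff (𝓡 n) 𝓘(ℝ, ℝ) ∞ fun x ↦ h x (U x) (U' x)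
  symm (x : M) (u v : ProjCotractor n x) : h x u v = h x v u
  nondegenerate (x : M) (u : ProjCotractor n x) (hu : jetEval _ x u = 0)
    (h0 : ∀ v : ProjCotractor n x, jetEval _ x v = 0 → h x u v = 0) : u = 0

/-- The bilinear form `h` is parallel for the projective cotractor connection. -/
def IsParallelForm (h : Π x : M, LinearMap.BilinForm ℝ (ProjCotractor n x)) : Prop :=
  ∀ U U' : Π x : M, ProjCotractor n x, IsSmoothProj nabla U → IsSmoothProj nabla U' →
    ∀ (x : M) (X : TangentSpace (𝓡 n) x),
      mvfderiv (𝓡 n) (fun y ↦ h y (U y) (U' y)) x X =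
        h x (projTractorConn nabla U x X) (U' x) + h x (U x) (projTractorConn nabla U' x X)

lemma cometric_add_left (x : M) (μ μ' ν : TangentSpace (𝓡 n) x →ₗ[ℝ] ℝ) :
    cometric g x (μ + μ') ν = cometric g x μ ν + cometric g x μ' ν := by
  simp only [cometric, LinearMap.add_apply, mul_add, add_mul, Finset.sum_add_distrib]

lemma cometric_smul_left (x : M) (c : ℝ) (μ ν : TangentSpace (𝓡 n) x →ₗ[ℝ] ℝ) :
    cometric g x (c • μ) ν = c * cometric g x μ ν := by
  simp only [cometric, LinearMap.smul_apply, smul_eq_mul, Finset.mul_sum]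
  exact Finset.sum_congr rfl fun i _ ↦ Finset.sum_congr rfl fun j _ ↦ by ring

lemma cometric_add_right (x : M) (μ ν ν' : TangentSpace (𝓡 n) x →ₗ[ℝ] ℝ) :
    cometric g x μ (ν + ν') = cometric g x μ ν + cometric g x μ ν' := by
  simp only [cometric, LinearMap.add_apply, mul_add, Finset.sum_add_distrib]

lemma cometric_smul_right (x : M) (c : ℝ) (μ ν : TangentSpace (𝓡 n) x →ₗ[ℝ] ℝ) :
    cometric g x μ (c • ν) = c * cometric g x μ ν := by
  simp only [cometric, LinearMap.smul_apply, smul_eq_mul, Finset.mul_sum]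
  exact Finset.sum_congr rfl fun i _ ↦ Finset.sum_congr rfl fun j _ ↦ by ring

/-- The bilinear form `(μ ∣ σ), (μ' ∣ σ') ↦ gᵃᵇ μₐ μ'_b + lam σ σ'` on projective cotractors, in
the splitting by `∇` and the trivialisation of the densities by `g`. -/
def projSubMetric (lam : ℝ) (x : M) : LinearMap.BilinForm ℝ (ProjCotractor n x) :=
  LinearMap.mk₂ ℝ
    (fun u v ↦ cometric g x (scale g _ x ∘ₗ projMu nabla x u) (scale g _ x ∘ₗ projMu nabla x v) +
      lam * (scale g _ x (projSigma nabla x u) * scale g _ x (projSigma nabla x v)))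
    (fun _ _ _ ↦ by
      simp only [map_add, LinearMap.comp_add, cometric_add_left]; ring)
    (fun _ _ _ ↦ by
      simp only [map_smul, LinearMap.comp_smul, cometric_smul_left, smul_eq_mul]; ring)
    (fun _ _ _ ↦ by
      simp only [map_add, LinearMap.comp_add, cometric_add_right]; ring)
    (fun _ _ _ ↦ by
      simp only [map_smul, LinearMap.comp_smul, cometric_smul_right, smul_eq_mul]; ring)

end ProjectiveTractors

section ConformalTractors

variable [IsManifold (𝓡 n) ∞ M] [NeZero n] [T2Space M] (g : PseudoMetric n M)
  (nabla : AffineConnection n M)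

/-- The slot `τ` of a conformal cotractor `(τ ∣ μ ∣ σ)` in the splitting by `g`. -/
def confTau (x : M) : ConfCotractor g x →ₗ[ℝ] ℝ :=
  LinearMap.fst ℝ _ _ ∘ₗ (confSplit g nabla x).toLinearMap

/-- The slot `μ` of a conformal cotractor `(τ ∣ μ ∣ σ)` in the splitting by `g`. -/
def confMu (x : M) : ConfCotractor g x →ₗ[ℝ] (TangentSpace (𝓡 n) x →ₗ[ℝ] ℝ) :=
  LinearMap.fst ℝ _ _ ∘ₗ LinearMap.snd ℝ _ _ ∘ₗ (confSplit g nabla x).toLinearMap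

/-- The slot `σ` of a conformal cotractor `(τ ∣ μ ∣ σ)` in the splitting by `g`. -/
def confSigma (x : M) : ConfCotractor g x →ₗ[ℝ] ℝ :=
  LinearMap.snd ℝ _ _ ∘ₗ LinearMap.snd ℝ _ _ ∘ₗ (confSplit g nabla x).toLinearMap

/-- Smoothness of a section of the conformal cotractor bundle. -/
def IsSmoothConf (V : Π x : M, ConfCotractor g x) : Prop :=
  ContMDiff (𝓡 n) 𝓘(ℝ, ℝ) ∞ (fun y ↦ confTau g nabla y (V y)) ∧
    (∀ (x : M) (i : Fin n), ContMDiffAt (𝓡 n) 𝓘(ℝ, ℝ) ∞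
      (fun y ↦ confMu g nabla y (V y) (coordFrame x y i)) x) ∧
    ContMDiff (𝓡 n) 𝓘(ℝ, ℝ) ∞ (fun y ↦ confSigma g nabla y (V y))

/-- The conformal cotractor connection: `∇̃_X (τ ∣ μ ∣ σ)` is
`(X τ - gᵇᶜ P̃(X, e_b) μ_c ∣ ∇_X μ + g(X, ·) τ + P̃(X, ·) σ ∣ X σ - μ(X))` in the splitting by
`g`. -/
def confTractorConn (V : Π x : M, ConfCotractor g x) (x : M) (X : TangentSpace (𝓡 n) x) :
    ConfCotractor g x :=
  (confSplit g nabla x).symm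
    (mvfderiv (𝓡 n) (fun y ↦ confTau g nabla y (V y)) x X -
      metricTrace g x (fun u v ↦ confSchouten g nabla x X u * confMu g nabla x (V x) v),
    formDeriv nabla (fun y ↦ confMu g nabla y (V y)) x X +
      (stdBasis n x).constr ℝ (fun i ↦
        g.val x X (stdBasis n x i) * confTau g nabla x (V x) +
          confSchouten g nabla x X (stdBasis n x i) * confSigma g nabla x (V x)),
    mvfderiv (𝓡 n) (fun y ↦ confSigma g nabla y (V y)) x X - confMu g nabla x (V x) X)

/-- The conformal tractor metric on cotractors: `gᵃᵇ μₐ μ'_b + σ τ' + τ σ'`. -/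
def confTractorMetric (x : M) (u v : ConfCotractor g x) : ℝ :=
  cometric g x (confMu g nabla x u) (confMu g nabla x v) +
    confSigma g nabla x u * confTau g nabla x v + confTau g nabla x u * confSigma g nabla x v

/-- The tractor `I = (1, 0, -J̃/n)`, as a linear form on cotractors:
`(τ ∣ μ ∣ σ) ↦ τ - (J̃/n) σ`. -/
def tractorI (x : M) : ConfCotractor g x →ₗ[ℝ] ℝ :=
  confTau g nabla x - (confJ g nabla x / n) • confSigma g nabla x

/-- A tractor (a field of linear forms on cotractors) is parallel for the connection dual to the
cotractor connection. -/
def IsParallelTractor (I : Π x : M, ConfCotractor g x →ₗ[ℝ] ℝ) : Prop :=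
  ∀ V : Π x : M, ConfCotractor g x, IsSmoothConf g nabla V →
    ContMDiff (𝓡 n) 𝓘(ℝ, ℝ) ∞ (fun y ↦ I y (V y)) ∧
    ∀ (x : M) (X : TangentSpace (𝓡 n) x),
      mvfderiv (𝓡 n) (fun y ↦ I y (V y)) x X = I x (confTractorConn g nabla V x X)

/-- The map `ι : (μ ∣ σ) ↦ ((J̃/n) σ ∣ μ ∣ σ)` from projective to conformal cotractors, in the
splittings by `∇` and `g` and the trivialisation of the density bundles by `g`. -/
def iota (x : M) : ProjCotractor n x →ₗ[ℝ] ConfCotractor g x :=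
  (confSplit g nabla x).symm.toLinearMap ∘ₗ
    ((confJ g nabla x / n) • (scale g _ x ∘ₗ projSigma nabla x)).prod
      ((LinearMap.compRight ℝ (scale g _ x) ∘ₗ projMu nabla x).prod
        (scale g _ x ∘ₗ projSigma nabla x))

/-- The metric `g`, with Levi-Civita connection `∇`, is Einstein. -/
def IsEinstein : Prop :=
  ∃ c : ℝ, ∀ (x : M) (u v : TangentSpace (𝓡 n) x), ricci nabla x u v = c * g.val x u v

end ConformalTractors

end Tractor

end

/-!
In the trivialisation of the density bundles by `g`, both tractor connections become expressions
in the Levi-Civita derivatives of ordinary functions and 1-forms, and what is left is algebra with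
the Schouten tensors.

The analytic input is that the Levi-Civita connection preserves this trivialisation and the inverse
metric. In the coordinate frame at `x`, metric compatibility says that the Gram matrix `G` and the
connection form `C` satisfy `dG = C G + (C G)ᵀ` (`hasDerivAt_coordGram_chartLine`). Jacobi's formula
turns this into `d |det G|^(r/2) = r tr C |det G|^(r/2)` (`mvfderiv_volFactor`), which cancels the
term by which the connection on densities differs from differentiation of coefficients
(`scale_densityDeriv`, `scale_comp_densityFormDeriv`). The derivative of an inverse matrix gives
`dG⁻¹ = -(G⁻¹ C + Cᵀ G⁻¹)`, that is, `∇ gᵃᵇ = 0` (`mvfderiv_cometric`).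

If `Ric = c g` and `b = c / (2 (n - 1))`, then `J̃ = n b`, `P̃ = b g` and `P = 2 b g`. Hence the image
of `ι`, on which `τ = b σ`, is the kernel of `I`. In the derivative of `I` the terms from `P̃` and
from `J̃/n` cancel, so `I` is parallel and its kernel is preserved by the conformal connection.
On this kernel the middle slot of the conformal connection has the terms
`g τ + P̃ σ = 2 b σ g = P σ`, which are those of the projective connection, and the mixed terms of
the tractor metric are `σ τ' + τ σ' = 2 b σ σ'`, which is the last term of the sub-metric.
-/

namespace Tractor

/-! ### Derivatives of determinants and inverse matrices -/

/-- Jacobi's formula for the derivative of a determinant along a curve of matrices. -/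
lemma hasDerivAt_matrix_det {m : ℕ} {A : ℝ → Matrix (Fin m) (Fin m) ℝ}
    {A' : Matrix (Fin m) (Fin m) ℝ} {t : ℝ}
    (h : ∀ i j, HasDerivAt (fun s ↦ A s i j) (A' i j) t) :
    HasDerivAt (fun s ↦ (A s).det) ((A t).adjugate * A').trace t := by
  have h1 : HasDerivAt (fun s ↦ ∑ σ : Equiv.Perm (Fin m), ((Equiv.Perm.sign σ : ℤ) : ℝ) *
      ∏ i, A s (σ i) i) (∑ σ : Equiv.Perm (Fin m), ((Equiv.Perm.sign σ : ℤ) : ℝ) *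
        ∑ i, (∏ j ∈ Finset.univ.erase i, A t (σ j) j) • A' (σ i) i) t :=
    HasDerivAt.fun_sum fun σ _ ↦
      (HasDerivAt.fun_finsetProd fun i _ ↦ h (σ i) i).const_mul _
  simp only [← Matrix.det_apply'] at h1
  refine h1.congr_deriv ?_
  have h2 : ∀ i, ((A t).adjugate * A') i i = ∑ σ : Equiv.Perm (Fin m),
      ((Equiv.Perm.sign σ : ℤ) : ℝ) * ((∏ j ∈ Finset.univ.erase i, A t (σ j) j) • A' (σ i) i) := by
    intro i
    have h3 : ((A t).adjugate * A') i i = ((A t).updateCol i fun k ↦ A' k i).det := by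
      rw [← Matrix.cramer_apply, Matrix.cramer_eq_adjugate_mulVec]
      rfl
    rw [h3, Matrix.det_apply']
    refine Finset.sum_congr rfl fun σ _ ↦ ?_
    rw [← Finset.prod_erase_mul Finset.univ _ (Finset.mem_univ i), Matrix.updateCol_self,
      smul_eq_mul]
    congr 2
    refine Finset.prod_congr rfl fun j hj ↦ ?_
    rw [Matrix.updateCol_ne (Finset.ne_of_mem_erase hj)]
  simp only [Matrix.trace, Matrix.diag_apply, h2, Finset.mul_sum]
  exact Finset.sum_comm

lemma hasDerivAt_matrix_inv {m : ℕ} {A : ℝ → Matrix (Fin m) (Fin m) ℝ}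
    {A' : Matrix (Fin m) (Fin m) ℝ} {t : ℝ}
    (h : ∀ i j, HasDerivAt (fun s ↦ A s i j) (A' i j) t) (h0 : (A t).det ≠ 0) (i j : Fin m) :
    HasDerivAt (fun s ↦ (A s)⁻¹ i j) ((-((A t)⁻¹ * A' * (A t)⁻¹)) i j) t := by
  have hdet := hasDerivAt_matrix_det h
  have hdiff : ∀ i j, DifferentiableAt ℝ (fun s ↦ (A s)⁻¹ i j) t := by
    intro i j
    have hadj : DifferentiableAt ℝ (fun s ↦ (A s).adjugate i j) t := by
      simp only [Matrix.adjugate_apply]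
      refine (hasDerivAt_matrix_det (A := fun s ↦ (A s).updateRow j (Pi.single i 1))
        (A' := A'.updateRow j 0) fun k l ↦ ?_).differentiableAt
      by_cases hk : k = j
      · subst hk
        simpa using hasDerivAt_const t _
      · simpa [Matrix.updateRow_apply, hk] using h k l
    simp only [Matrix.inv_def, Matrix.smul_apply, Ring.inverse_eq_inv', smul_eq_mul]
    exact (hdet.differentiableAt.inv h0).mul hadj
  let B : Matrix (Fin m) (Fin m) ℝ := Matrix.of fun i j ↦ deriv (fun s ↦ (A s)⁻¹ i j) t
  have hB : ∀ i j, HasDerivAt (fun s ↦ (A s)⁻¹ i j) (B i j) t := fun i j ↦ (hdiff i j).hasDerivAt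
  have hprod : B * A t + (A t)⁻¹ * A' = 0 := by
    ext i j
    have h1 : HasDerivAt (fun s ↦ ((A s)⁻¹ * A s) i j)
        (∑ k, (B i k * A t k j + (A t)⁻¹ i k * A' k j)) t := by
      simp only [Matrix.mul_apply]
      exact HasDerivAt.fun_sum fun k _ ↦ (hB i k).mul (h k j)
    have h2 : (fun s ↦ ((A s)⁻¹ * A s) i j) =ᶠ[𝓝 t]
        fun _ ↦ (1 : Matrix (Fin m) (Fin m) ℝ) i j := by
      filter_upwards [hdet.continuousAt.eventually_ne h0] with s hs
      rw [Matrix.nonsing_inv_mul _ (isUnit_iff_ne_zero.2 hs)]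
    have h3 := h1.unique ((hasDerivAt_const t _).congr_of_eventuallyEq h2)
    simpa [Matrix.mul_apply, Finset.sum_add_distrib] using h3
  have hAi : A t * (A t)⁻¹ = 1 := Matrix.mul_nonsing_inv _ (isUnit_iff_ne_zero.2 h0)
  have hBeq : B = -((A t)⁻¹ * A' * (A t)⁻¹) := by
    rw [← mul_one B, ← hAi, ← mul_assoc, eq_neg_of_add_eq_zero_left hprod, neg_mul]
  rw [← hBeq]
  exact hB i j

variable {n : ℕ} {M : Type*} [TopologicalSpace M] [ChartedSpace (EuclideanSpace ℝ (Fin n)) M]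

lemma contMDiffAt_matrix_inv {A : M → Matrix (Fin n) (Fin n) ℝ} {x : M}
    (hA : ∀ i j, ContMDiffAt (𝓡 n) 𝓘(ℝ, ℝ) ∞ (fun y ↦ A y i j) x) (h0 : (A x).det ≠ 0)
    (i j : Fin n) : ContMDiffAt (𝓡 n) 𝓘(ℝ, ℝ) ∞ (fun y ↦ (A y)⁻¹ i j) x := by
  have hadj : ContMDiffAt (𝓡 n) 𝓘(ℝ, ℝ) ∞ (fun y ↦ (A y).adjugate i j) x := by
    simp only [Matrix.adjugate_apply]
    refine contMDiffAt_det (A := fun y ↦ (A y).updateRow j (Pi.single i 1)) fun k l ↦ ?_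
    by_cases hk : k = j
    · subst hk
      simpa using! contMDiffAt_const
    · simpa [Matrix.updateRow_apply, hk] using! hA k l
  simp only [Matrix.inv_def, Matrix.smul_apply, Ring.inverse_eq_inv', smul_eq_mul]
  exact ((contMDiffAt_det hA).inv₀ h0).mul hadj

/-! ### Differentiation along coordinate lines -/

/-- The straight line through `x` with velocity `X` in the preferred chart at `x`. -/
noncomputable def chartLine (x : M) (X : TangentSpace (𝓡 n) x) (t : ℝ) : M :=
  let v : EuclideanSpace ℝ (Fin n) := X
  (extChartAt (𝓡 n) x).symm (extChartAt (𝓡 n) x x + t • v)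

lemma chartLine_zero (x : M) (X : TangentSpace (𝓡 n) x) : chartLine x X 0 = x := by
  let v : EuclideanSpace ℝ (Fin n) := X
  change (extChartAt (𝓡 n) x).symm (extChartAt (𝓡 n) x x + (0 : ℝ) • v) = x
  rw [zero_smul, add_zero, extChartAt_to_inv]

lemma tendsto_chartLine (x : M) (X : TangentSpace (𝓡 n) x) :
    Filter.Tendsto (chartLine x X) (𝓝 0) (𝓝 x) := by
  have h := continuousAt_extChartAt_symm (I := 𝓡 n) x
  rw [ContinuousAt, extChartAt_to_inv] at h
  refine h.comp ?_
  let v : EuclideanSpace ℝ (Fin n) := X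
  have h2 : Continuous fun t : ℝ ↦ extChartAt (𝓡 n) x x + t • v := by fun_prop
  simpa using h2.tendsto 0

lemma hasDerivAt_chartLine {f : M → ℝ} {x : M} (hf : MDifferentiableAt (𝓡 n) 𝓘(ℝ, ℝ) f x)
    (X : TangentSpace (𝓡 n) x) :
    HasDerivAt (fun t ↦ f (chartLine x X t)) (mvfderiv (𝓡 n) f x X) 0 := by
  rw [mvfderiv_eq_fderiv_inChart hf]
  have hd : DifferentiableAt ℝ (inChart f x) (extChartAt (𝓡 n) x x) := by
    rw [mdifferentiableAt_iff] at hf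
    simpa [inChart, differentiableWithinAt_univ] using! hf.2
  let v : EuclideanSpace ℝ (Fin n) := X
  have hl : HasDerivAt (fun t : ℝ ↦ extChartAt (𝓡 n) x x + t • v) v 0 := by
    simpa using ((hasDerivAt_id (0 : ℝ)).smul_const v).const_add (extChartAt (𝓡 n) x x)
  have hd' : HasFDerivAt (inChart f x) (fderiv ℝ (inChart f x) (extChartAt (𝓡 n) x x))
      (extChartAt (𝓡 n) x x + (0 : ℝ) • v) := by
    simpa using hd.hasFDerivAt
  exact hd'.comp_hasDerivAt 0 hl

/-- The directional derivative of a function can be read off along a coordinate line. -/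
lemma mvfderiv_eq_of_hasDerivAt_chartLine {f : M → ℝ} {x : M} {X : TangentSpace (𝓡 n) x} {d : ℝ}
    (hf : MDifferentiableAt (𝓡 n) 𝓘(ℝ, ℝ) f x) {φ : ℝ → ℝ}
    (hφ : (fun t ↦ f (chartLine x X t)) =ᶠ[𝓝 0] φ) (hd : HasDerivAt φ d 0) :
    mvfderiv (𝓡 n) f x X = d :=
  (hasDerivAt_chartLine hf X).unique (hd.congr_of_eventuallyEq hφ)

lemma eventually_chartLine_mem_source (x : M) (X : TangentSpace (𝓡 n) x) :
    ∀ᶠ t in 𝓝 (0 : ℝ), chartLine x X t ∈ (chartAt (EuclideanSpace ℝ (Fin n)) x).source :=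
  (tendsto_chartLine x X).eventually ((chartAt _ x).open_source.mem_nhds (mem_chart_source _ x))

variable [IsManifold (𝓡 n) ∞ M] (g : PseudoMetric n M) (nabla : AffineConnection n M)

/-! ### The inverse metric -/

lemma gram_transpose (x : M) (v : Fin n → TangentSpace (𝓡 n) x) :
    (gram g x v).transpose = gram g x v := by
  ext i j
  exact g.symm x _ _

/-- Lowering and then raising an index is the identity: `gᵃᵇ X_a μ_b = μ(X)`. -/
lemma cometric_val_left (x : M) (X : TangentSpace (𝓡 n) x) (μ : TangentSpace (𝓡 n) x →ₗ[ℝ] ℝ) :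
    cometric g x (g.val x X : TangentSpace (𝓡 n) x →ₗ[ℝ] ℝ) μ = μ X := by
  have h1 : ∀ i, g.val x X (stdBasis n x i) =
      ∑ k, (stdBasis n x).repr X k * gram g x (stdBasis n x) k i := by
    intro i
    conv_lhs => rw [← (stdBasis n x).sum_repr X]
    simp only [map_sum, map_smul, FunLike.coe_sum, Finset.sum_apply, smul_apply, smul_eq_mul, gram,
      Matrix.of_apply]
  have h2 : ∀ k j, ∑ i, gram g x (stdBasis n x) k i * gInv g x i j =
      (1 : Matrix (Fin n) (Fin n) ℝ) k j := by
    intro k j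
    rw [← Matrix.mul_apply, gInv, Matrix.mul_nonsing_inv _
      (isUnit_iff_ne_zero.2 (det_gram_stdBasis_ne_zero g x))]
  have h3 : μ X = ∑ j, (stdBasis n x).repr X j * μ (stdBasis n x j) := by
    conv_lhs => rw [← (stdBasis n x).sum_repr X]
    simp only [map_sum, map_smul, smul_eq_mul]
  rw [h3, cometric, Finset.sum_comm]
  refine Finset.sum_congr rfl fun j _ ↦ ?_
  have h4 : ∑ i, gInv g x i j * g.val x X (stdBasis n x i) = (stdBasis n x).repr X j := by
    calc _ = ∑ i, ∑ k, (stdBasis n x).repr X k *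
          (gram g x (stdBasis n x) k i * gInv g x i j) := by
          refine Finset.sum_congr rfl fun i _ ↦ ?_
          rw [h1, Finset.mul_sum]
          exact Finset.sum_congr rfl fun k _ ↦ by ring
      _ = _ := by
          rw [Finset.sum_comm]
          simp only [← Finset.mul_sum, h2, Matrix.one_apply]
          simp
  rw [← h4, Finset.sum_mul]
  rfl

lemma cometric_comm (x : M) (μ ν : TangentSpace (𝓡 n) x →ₗ[ℝ] ℝ) :
    cometric g x μ ν = cometric g x ν μ := by
  have h : ∀ i j, gInv g x i j = gInv g x j i := fun i j ↦ by
    have := Matrix.transpose_nonsing_inv (gram g x (stdBasis n x))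
    rw [gram_transpose] at this
    exact congrFun (congrFun this j) i
  rw [cometric, cometric, Finset.sum_comm]
  refine Finset.sum_congr rfl fun j _ ↦ Finset.sum_congr rfl fun i _ ↦ ?_
  rw [h i j]
  ring

lemma eq_zero_of_cometric_eq_zero {x : M} {μ : TangentSpace (𝓡 n) x →ₗ[ℝ] ℝ}
    (h : ∀ ν, cometric g x μ ν = 0) : μ = 0 := by
  refine LinearMap.ext fun X ↦ ?_
  rw [← cometric_val_left g x X μ, cometric_comm, h]
  rfl

/-- The inverse metric may be computed in any basis. -/
lemma cometric_eq_of_det_ne_zero (x : M) {v : Fin n → TangentSpace (𝓡 n) x}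
    (hv : (stdBasis n x).det v ≠ 0) (μ ν : TangentSpace (𝓡 n) x →ₗ[ℝ] ℝ) :
    cometric g x μ ν = ∑ i, ∑ j, (gram g x v)⁻¹ i j * μ (v i) * ν (v j) := by
  set T := (stdBasis n x).toMatrix v with hT
  have hTu : IsUnit T.det := by
    rw [hT, ← Basis.det_apply]
    exact isUnit_iff_ne_zero.2 hv
  have hG : gram g x v = T.transpose * gram g x (stdBasis n x) * T := by
    ext i j
    conv_lhs => rw [gram, Matrix.of_apply, ← (stdBasis n x).sum_toMatrix_smul_self v i,
      ← (stdBasis n x).sum_toMatrix_smul_self v j]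
    simp only [map_sum, map_smul, Matrix.mul_apply, Matrix.transpose_apply, gram, Matrix.of_apply,
      FunLike.coe_sum, Finset.sum_apply, smul_apply, smul_eq_mul, Finset.sum_mul, Finset.mul_sum]
    refine Finset.sum_congr rfl fun a _ ↦ Finset.sum_congr rfl fun b _ ↦ ?_
    ring
  have hinv : T * (gram g x v)⁻¹ * T.transpose = gInv g x := by
    rw [hG, Matrix.mul_inv_rev, Matrix.mul_inv_rev, ← mul_assoc, Matrix.mul_nonsing_inv _ hTu,
      one_mul, mul_assoc, Matrix.nonsing_inv_mul _ (by rwa [Matrix.det_transpose]), mul_one, gInv]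
  have hexp : ∀ (θ : TangentSpace (𝓡 n) x →ₗ[ℝ] ℝ) (i : Fin n),
      θ (v i) = ∑ k, T k i * θ (stdBasis n x k) := by
    intro θ i
    conv_lhs => rw [← (stdBasis n x).sum_toMatrix_smul_self v i]
    simp only [map_sum, map_smul, smul_eq_mul, hT]
  have hdot : ∀ (B : Matrix (Fin n) (Fin n) ℝ) (a b : Fin n → ℝ),
      ∑ i, ∑ j, B i j * a i * b j = a ⬝ᵥ B.mulVec b := by
    intro B a b
    simp only [dotProduct, Matrix.mulVec, Finset.mul_sum]
    exact Finset.sum_congr rfl fun i _ ↦ Finset.sum_congr rfl fun j _ ↦ by ring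
  have hvec : ∀ θ : TangentSpace (𝓡 n) x →ₗ[ℝ] ℝ,
      (fun i ↦ θ (v i)) = T.transpose.mulVec fun k ↦ θ (stdBasis n x k) :=
    fun θ ↦ funext fun i ↦ hexp θ i
  rw [cometric, hdot _ (fun i ↦ μ (stdBasis n x i)) (fun j ↦ ν (stdBasis n x j)),
    hdot _ (fun i ↦ μ (v i)) (fun j ↦ ν (v j)), hvec μ, hvec ν, ← hinv, Matrix.mulVec_transpose,
    ← Matrix.dotProduct_mulVec, Matrix.mulVec_mulVec, Matrix.mulVec_mulVec, mul_assoc]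

/-! ### The metric in the coordinate frame -/

/-- The matrix-valued function `y ↦ g(Eᵢ, Eⱼ)`, for the coordinate frame `E` at `x`. -/
noncomputable def coordGram (x y : M) : Matrix (Fin n) (Fin n) ℝ := gram g y (coordFrame x y)

lemma coordGram_self (x : M) : coordGram g x x = gram g x (stdBasis n x) := by
  rw [coordGram, coordFrame_self]

lemma det_coordGram_self_ne_zero (x : M) : (coordGram g x x).det ≠ 0 := by
  rw [coordGram_self]
  exact det_gram_stdBasis_ne_zero g x

lemma contMDiffAt_coordGram (x : M) (i j : Fin n) :
    ContMDiffAt (𝓡 n) 𝓘(ℝ, ℝ) ∞ (fun y ↦ coordGram g x y i j) x := by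
  have h := ContMDiffAt.clm_bundle_apply₂ (F₃ := ℝ) (E₃ := fun _ : M ↦ ℝ) (b := fun y : M ↦ y)
    (g.contMDiff x)
    (contMDiffAt_coordField x (stdBasis n x i) (mem_chart_source _ x))
    (contMDiffAt_coordField x (stdBasis n x j) (mem_chart_source _ x))
  rw [contMDiffAt_totalSpace] at h
  exact h.2

/-- The matrix at `x` of the connection form of `∇` in the coordinate frame at `x`, in the
direction `X`: its `(i, k)` entry is the `k`-th component of `∇_X Eᵢ`. -/
noncomputable def connMatrix (x : M) (X : TangentSpace (𝓡 n) x) : Matrix (Fin n) (Fin n) ℝ :=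
  Matrix.of fun i k ↦ (stdBasis n x).repr (nabla (fun y ↦ coordFrame x y i) x X) k

lemma trace_connMatrix (x : M) (X : TangentSpace (𝓡 n) x) :
    (connMatrix nabla x X).trace = connTrace nabla x X := by
  simp [connMatrix, connTrace, Matrix.trace, LinearMap.sum_apply]

lemma sum_connMatrix_mul (x : M) (X : TangentSpace (𝓡 n) x)
    (μ : TangentSpace (𝓡 n) x →ₗ[ℝ] ℝ) (i : Fin n) :
    ∑ k, connMatrix nabla x X i k * μ (stdBasis n x k) =
      μ (nabla (fun y ↦ coordFrame x y i) x X) := by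
  conv_rhs => rw [← (stdBasis n x).sum_repr (nabla (fun y ↦ coordFrame x y i) x X)]
  simp only [map_sum, map_smul, smul_eq_mul, connMatrix, Matrix.of_apply]

variable {g nabla}

lemma mdifferentiableAt_coordFrame (x : M) (i : Fin n) :
    MDifferentiableAt (𝓡 n) ((𝓡 n).prod 𝓘(ℝ, EuclideanSpace ℝ (Fin n)))
      (fun y ↦ TotalSpace.mk' (EuclideanSpace ℝ (Fin n)) y (coordFrame x y i)) x :=
  (contMDiffAt_coordField x (stdBasis n x i) (mem_chart_source _ x)).mdifferentiableAt (by simp)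

/-- Metric compatibility in the coordinate frame: `dG = C G + (C G)ᵀ`, where `G` is the Gram
matrix of the frame and `C` is the connection form. -/
lemma hasDerivAt_coordGram_chartLine (hLC : IsLeviCivita g nabla) (x : M) (X : TangentSpace (𝓡 n) x)
    (i j : Fin n) :
    HasDerivAt (fun t ↦ coordGram g x (chartLine x X t) i j)
      ((connMatrix nabla x X * coordGram g x x +
        (connMatrix nabla x X * coordGram g x x).transpose) i j) 0 := by
  refine (hasDerivAt_chartLine
    ((contMDiffAt_coordGram g x i j).mdifferentiableAt (by simp)) X).congr_deriv ?_
  have h := hLC.metric x X (fun y ↦ coordFrame x y i) (fun y ↦ coordFrame x y j)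
    (mdifferentiableAt_coordFrame x i) (mdifferentiableAt_coordFrame x j)
  rw [coordGram_self]
  have hC : ∀ i j, (connMatrix nabla x X * gram g x (stdBasis n x)) i j =
      g.val x (nabla (fun y ↦ coordFrame x y i) x X) (stdBasis n x j) := by
    intro i j
    have h2 := sum_connMatrix_mul nabla x X
      (g.val x (stdBasis n x j) : TangentSpace (𝓡 n) x →ₗ[ℝ] ℝ) i
    rw [g.symm]
    refine Eq.trans ?_ h2
    rw [Matrix.mul_apply]
    exact Finset.sum_congr rfl fun k _ ↦ congrArg _ (g.symm x _ _)
  rw [Matrix.add_apply, Matrix.transpose_apply, hC, hC]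
  refine h.trans ?_
  rw [coordFrame_self, g.symm x (stdBasis n x i)]

/-- The connection that a Levi-Civita connection induces on densities preserves the trivialisation
by the metric. -/
lemma mvfderiv_volFactor (hLC : IsLeviCivita g nabla) (r : ℝ) (x : M)
    (X : TangentSpace (𝓡 n) x) :
    mvfderiv (𝓡 n) (volFactor g r x) x X = r * connTrace nabla x X * volFactor g r x x := by
  have hG0 := det_coordGram_self_ne_zero g x
  have h1 := hasDerivAt_matrix_det (hasDerivAt_coordGram_chartLine hLC x X)
  rw [chartLine_zero] at h1
  set G := coordGram g x x with hG
  set C := connMatrix nabla x X with hC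
  have hGt : G.transpose = G := gram_transpose g x _
  have htr : (G.adjugate * (C * G + (C * G).transpose)).trace =
      2 * connTrace nabla x X * G.det := by
    have e1 : (G.adjugate * (C * G)).trace = G.det * C.trace := by
      rw [Matrix.trace_mul_comm, mul_assoc, Matrix.mul_adjugate, Matrix.mul_smul, mul_one,
        Matrix.trace_smul, smul_eq_mul]
    have e2 : (G.adjugate * (C * G).transpose).trace = G.det * C.trace := by
      rw [Matrix.transpose_mul, hGt, ← mul_assoc, Matrix.adjugate_mul, smul_mul_assoc,
        one_mul, Matrix.trace_smul, Matrix.trace_transpose, smul_eq_mul]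
    rw [mul_add, Matrix.trace_add, e1, e2, hC, trace_connMatrix]
    ring
  rw [htr] at h1
  have hG0' : (coordGram g x (chartLine x X 0)).det ≠ 0 := by rwa [chartLine_zero]
  have h3 := ((hasDerivAt_abs hG0').comp 0 h1).rpow_const (p := r / 2)
    (Or.inl (abs_ne_zero.2 hG0'))
  refine mvfderiv_eq_of_hasDerivAt_chartLine
    ((contMDiffAt_volFactor g r x).mdifferentiableAt (by simp)) (Filter.EventuallyEq.refl _ _)
    (h3.congr_deriv ?_)
  have hs : (SignType.sign G.det : ℝ) * G.det = |G.det| := sign_mul_self _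
  have hs0 := abs_ne_zero.2 hG0
  change _ = r * connTrace nabla x X * |G.det| ^ (r / 2)
  simp only [Function.comp_apply, chartLine_zero, ← hG]
  rw [Real.rpow_sub_one hs0]
  field_simp
  linear_combination connTrace nabla x X * r * hs

lemma contMDiffAt_scale {r : ℝ} {s : Π y : M, Density n r y} {x : M}
    (hs : ContMDiffAt (𝓡 n) 𝓘(ℝ, ℝ) ∞ (coordCoeff s x) x) :
    ContMDiffAt (𝓡 n) 𝓘(ℝ, ℝ) ∞ (fun y ↦ scale g r y (s y)) x := by
  refine ((contMDiffAt_volFactor g r x).mul hs).congr_of_eventuallyEq ?_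
  filter_upwards [(chartAt (EuclideanSpace ℝ (Fin n)) x).open_source.mem_nhds
    (mem_chart_source _ x)] with y hy
  exact scale_eq g s x hy

/-- The covariant derivative of a density is the ordinary derivative of the function that
represents it in the trivialisation by the metric. -/
lemma scale_densityDeriv (hLC : IsLeviCivita g nabla) {r : ℝ} {s : Π y : M, Density n r y} {x : M}
    (hs : ContMDiffAt (𝓡 n) 𝓘(ℝ, ℝ) ∞ (coordCoeff s x) x) (X : TangentSpace (𝓡 n) x) :
    scale g r x (densityDeriv nabla s x X) =
      mvfderiv (𝓡 n) (fun y ↦ scale g r y (s y)) x X := by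
  have hV := (contMDiffAt_volFactor g r x).mdifferentiableAt (by simp)
  have hs' := hs.mdifferentiableAt (by simp)
  symm
  refine mvfderiv_eq_of_hasDerivAt_chartLine
    (φ := fun t ↦ volFactor g r x (chartLine x X t) * coordCoeff s x (chartLine x X t))
    ((contMDiffAt_scale hs).mdifferentiableAt (by simp)) ?_
    (((hasDerivAt_chartLine hV X).mul (hasDerivAt_chartLine hs' X)).congr_deriv ?_)
  · filter_upwards [eventually_chartLine_mem_source x X] with t ht
    exact scale_eq g s x ht
  · have h1 : scale g r x (stdDensity n r x) = volFactor g r x x := by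
      change |(gram g x (stdBasis n x)).det| ^ (r / 2) *
        Density.coeff (stdBasis n x) (stdDensity n r x) = _
      rw [stdDensity_stdBasis, mul_one, volFactor, coordFrame_self]
    rw [chartLine_zero, mvfderiv_volFactor hLC, densityDeriv, LinearMap.smulRight_apply, map_smul,
      h1]
    simp only [LinearMap.add_apply, LinearMap.smul_apply, ContinuousLinearMap.coe_coe, smul_eq_mul]
    ring

lemma contMDiffAt_cometric {μ ν : Π y : M, TangentSpace (𝓡 n) y →ₗ[ℝ] ℝ} {x : M}
    (hμ : ∀ i, ContMDiffAt (𝓡 n) 𝓘(ℝ, ℝ) ∞ (fun y ↦ μ y (coordFrame x y i)) x)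
    (hν : ∀ i, ContMDiffAt (𝓡 n) 𝓘(ℝ, ℝ) ∞ (fun y ↦ ν y (coordFrame x y i)) x) :
    ContMDiffAt (𝓡 n) 𝓘(ℝ, ℝ) ∞ (fun y ↦ cometric g y (μ y) (ν y)) x := by
  have h : ContMDiffAt (𝓡 n) 𝓘(ℝ, ℝ) ∞ (fun y ↦ ∑ i, ∑ j,
      (coordGram g x y)⁻¹ i j * μ y (coordFrame x y i) * ν y (coordFrame x y j)) x :=
    contMDiffAt_finsetSum fun i _ ↦ contMDiffAt_finsetSum fun j _ ↦
      ((contMDiffAt_matrix_inv (contMDiffAt_coordGram g x)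
        (det_coordGram_self_ne_zero g x) i j).mul (hμ i)).mul (hν j)
  refine h.congr_of_eventuallyEq ?_
  filter_upwards [(chartAt (EuclideanSpace ℝ (Fin n)) x).open_source.mem_nhds
    (mem_chart_source _ x)] with y hy
  exact cometric_eq_of_det_ne_zero g y (det_coordFrame_ne_zero x hy) _ _

lemma formDeriv_stdBasis (μ : Π y : M, TangentSpace (𝓡 n) y →ₗ[ℝ] ℝ) (x : M)
    (X : TangentSpace (𝓡 n) x) (i : Fin n) :
    formDeriv nabla μ x X (stdBasis n x i) =
      mvfderiv (𝓡 n) (fun y ↦ μ y (coordFrame x y i)) x X -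
        ∑ k, connMatrix nabla x X i k * μ x (stdBasis n x k) := by
  rw [formDeriv, Basis.constr_basis, sum_connMatrix_mul]

/-- The inverse metric is parallel. -/
lemma mvfderiv_cometric (hLC : IsLeviCivita g nabla)
    {μ ν : Π y : M, TangentSpace (𝓡 n) y →ₗ[ℝ] ℝ} {x : M}
    (hμ : ∀ i, ContMDiffAt (𝓡 n) 𝓘(ℝ, ℝ) ∞ (fun y ↦ μ y (coordFrame x y i)) x)
    (hν : ∀ i, ContMDiffAt (𝓡 n) 𝓘(ℝ, ℝ) ∞ (fun y ↦ ν y (coordFrame x y i)) x)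
    (X : TangentSpace (𝓡 n) x) :
    mvfderiv (𝓡 n) (fun y ↦ cometric g y (μ y) (ν y)) x X =
      cometric g x (formDeriv nabla μ x X) (ν x) + cometric g x (μ x) (formDeriv nabla ν x X) := by
  set G := coordGram g x x with hG
  set C := connMatrix nabla x X with hC
  have hG0 : G.det ≠ 0 := det_coordGram_self_ne_zero g x
  have hGinv : G⁻¹ = gInv g x := by rw [gInv, hG, coordGram_self]
  have hGt : G.transpose = G := gram_transpose g x _
  have hG0' : (coordGram g x (chartLine x X 0)).det ≠ 0 := by rwa [chartLine_zero]
  have hH := hasDerivAt_matrix_inv (hasDerivAt_coordGram_chartLine hLC x X) hG0'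
  -- metric compatibility for the inverse Gram matrix `H` reads `dH = -(H C + (H C)ᵀ)`
  have hH' : -(G⁻¹ * (C * G + (C * G).transpose) * G⁻¹) = -(G⁻¹ * C + C.transpose * G⁻¹) := by
    rw [Matrix.transpose_mul, hGt, mul_add, add_mul, ← mul_assoc, ← mul_assoc,
      Matrix.mul_nonsing_inv_cancel_right _ _ (isUnit_iff_ne_zero.2 hG0),
      Matrix.nonsing_inv_mul _ (isUnit_iff_ne_zero.2 hG0), one_mul]
  rw [hGinv] at hH'
  simp only [chartLine_zero, ← hG, ← hC, hGinv, hH'] at hH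
  have hm : ∀ i, HasDerivAt
      (fun t ↦ μ (chartLine x X t) (coordFrame x (chartLine x X t) i)) _ 0 := fun i ↦
    hasDerivAt_chartLine ((hμ i).mdifferentiableAt (by simp)) X
  have hv : ∀ i, HasDerivAt
      (fun t ↦ ν (chartLine x X t) (coordFrame x (chartLine x X t) i)) _ 0 := fun i ↦
    hasDerivAt_chartLine ((hν i).mdifferentiableAt (by simp)) X
  have hm0 : ∀ (θ : Π y : M, TangentSpace (𝓡 n) y →ₗ[ℝ] ℝ) i,
      θ (chartLine x X 0) (coordFrame x (chartLine x X 0) i) = θ x (stdBasis n x i) := by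
    intro θ i
    rw [← coordFrame_self]
    exact congrArg (fun y ↦ θ y (coordFrame x y i)) (chartLine_zero x X)
  refine mvfderiv_eq_of_hasDerivAt_chartLine
    ((contMDiffAt_cometric hμ hν).mdifferentiableAt (by simp))
    (φ := fun t ↦ ∑ i, ∑ j, (coordGram g x (chartLine x X t))⁻¹ i j *
      μ (chartLine x X t) (coordFrame x (chartLine x X t) i) *
      ν (chartLine x X t) (coordFrame x (chartLine x X t) j)) ?_
    ((HasDerivAt.fun_sum fun i _ ↦ HasDerivAt.fun_sum fun j _ ↦
      ((hH i j).mul (hm i)).mul (hv j)).congr_deriv ?_)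
  · filter_upwards [eventually_chartLine_mem_source x X] with t ht
    exact cometric_eq_of_det_ne_zero g _ (det_coordFrame_ne_zero x ht) _ _
  simp only [Pi.mul_apply, hm0, chartLine_zero, ← hG, hGinv]
  simp only [cometric, formDeriv_stdBasis, ← hC]
  generalize gInv g x = H
  have e1 : ∀ a b : Fin n → ℝ, ∑ i, ∑ j, (H * C) i j * a i * b j =
      ∑ i, ∑ j, H i j * a i * ∑ k, C j k * b k := by
    intro a b
    refine Finset.sum_congr rfl fun i _ ↦ ?_
    simp only [Matrix.mul_apply, Finset.sum_mul, Finset.mul_sum]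
    rw [Finset.sum_comm]
    exact Finset.sum_congr rfl fun k _ ↦ Finset.sum_congr rfl fun j _ ↦ by ring
  have e2 : ∀ a b : Fin n → ℝ, ∑ i, ∑ j, (C.transpose * H) i j * a i * b j =
      ∑ i, ∑ j, H i j * (∑ k, C i k * a k) * b j := by
    intro a b
    rw [Finset.sum_comm, Finset.sum_comm (f := fun i j ↦ H i j * (∑ k, C i k * a k) * b j)]
    refine Finset.sum_congr rfl fun j _ ↦ ?_
    simp only [Matrix.mul_apply, Matrix.transpose_apply, Finset.sum_mul, Finset.mul_sum]
    rw [Finset.sum_comm]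
    exact Finset.sum_congr rfl fun k _ ↦ Finset.sum_congr rfl fun i _ ↦ by ring
  have h1 := e1 (fun i ↦ μ x (stdBasis n x i)) (fun i ↦ ν x (stdBasis n x i))
  have h2 := e2 (fun i ↦ μ x (stdBasis n x i)) (fun i ↦ ν x (stdBasis n x i))
  simp only [Matrix.neg_apply, Matrix.add_apply, neg_mul, add_mul, mul_sub, sub_mul,
    Finset.sum_add_distrib, Finset.sum_sub_distrib, Finset.sum_neg_distrib, neg_add]
  linarith

lemma scale_comp_densityFormDeriv (hLC : IsLeviCivita g nabla) {r : ℝ}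
    {μ : Π y : M, TangentSpace (𝓡 n) y →ₗ[ℝ] Density n r y} {x : M}
    (hμ : ∀ i, ContMDiffAt (𝓡 n) 𝓘(ℝ, ℝ) ∞ (coordCoeff (fun y ↦ μ y (coordFrame x y i)) x) x)
    (X : TangentSpace (𝓡 n) x) :
    scale g r x ∘ₗ densityFormDeriv nabla μ x X =
      formDeriv nabla (fun y ↦ scale g r y ∘ₗ μ y) x X := by
  refine (stdBasis n x).ext fun i ↦ ?_
  rw [LinearMap.comp_apply, densityFormDeriv, formDeriv, Basis.constr_basis, Basis.constr_basis,
    map_sub, scale_densityDeriv hLC (hμ i)]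
  rfl

/-! ### Curvature of an Einstein metric -/

lemma confJ_of_einstein {c : ℝ}
    (hc : ∀ (x : M) (u v : TangentSpace (𝓡 n) x), ricci nabla x u v = c * g.val x u v)
    (x : M) : confJ g nabla x = n * (c / (2 * ((n : ℝ) - 1))) := by
  have h : metricTrace g x (ricci nabla x) = c * n := by
    rw [← sum_gInv_mul g x, metricTrace, Finset.mul_sum]
    refine Finset.sum_congr rfl fun i _ ↦ ?_
    rw [Finset.mul_sum]
    refine Finset.sum_congr rfl fun j _ ↦ ?_
    rw [hc]
    ring
  rw [confJ, h]
  ring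

lemma confSchouten_of_einstein {c : ℝ}
    (hc : ∀ (x : M) (u v : TangentSpace (𝓡 n) x), ricci nabla x u v = c * g.val x u v)
    (hn : 3 ≤ n) (x : M) (u v : TangentSpace (𝓡 n) x) :
    confSchouten g nabla x u v = c / (2 * ((n : ℝ) - 1)) * g.val x u v := by
  have hn' : (3 : ℝ) ≤ n := by exact_mod_cast hn
  have h1 : (n : ℝ) - 1 ≠ 0 := by linarith
  have h2 : (n : ℝ) - 2 ≠ 0 := by linarith
  rw [confSchouten, confJ_of_einstein hc, hc]
  field_simp
  ring

lemma projSchouten_of_einstein {c : ℝ}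
    (hc : ∀ (x : M) (u v : TangentSpace (𝓡 n) x), ricci nabla x u v = c * g.val x u v)
    (hn : 3 ≤ n) (x : M) (u v : TangentSpace (𝓡 n) x) :
    projSchouten nabla x u v = c / ((n : ℝ) - 1) * g.val x u v := by
  have hn' : (3 : ℝ) ≤ n := by exact_mod_cast hn
  have h1 : (n : ℝ) - 1 ≠ 0 := by linarith
  have h2 : (n : ℝ) + 1 ≠ 0 := by linarith
  have h3 : (n : ℝ) ^ 2 - 1 = (n - 1) * (n + 1) := by ring
  rw [projSchouten, hc, hc, g.symm x v u, h3]
  field_simp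

/-! ### Slots of tractors -/

/-- The trivialisation of a density line by the metric is an isomorphism. -/
lemma scale_injective (r : ℝ) (x : M) : Function.Injective (scale g r x) := by
  refine (injective_iff_map_eq_zero _).2 fun s hs ↦ ?_
  have h : |(gram g x (stdBasis n x)).det| ^ (r / 2) * Density.coeff (stdBasis n x) s = 0 := hs
  have h0 := (Real.rpow_pos_of_pos (abs_pos.2 (det_gram_stdBasis_ne_zero g x)) (r / 2)).ne'
  rw [Density.eq_smul s, (mul_eq_zero.1 h).resolve_left h0, zero_smul]

lemma scale_surjective (r : ℝ) (x : M) : Function.Surjective (scale g r x) := by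
  intro a
  have h0 := (Real.rpow_pos_of_pos (abs_pos.2 (det_gram_stdBasis_ne_zero g x)) (r / 2)).ne'
  refine ⟨(a / |(gram g x (stdBasis n x)).det| ^ (r / 2)) • stdDensity n r x, ?_⟩
  change |(gram g x (stdBasis n x)).det| ^ (r / 2) * Density.coeff (stdBasis n x) _ = a
  rw [map_smul, stdDensity_stdBasis, smul_eq_mul, mul_one]
  exact mul_div_cancel₀ a h0

section Slots

variable [T2Space M]

lemma projCotractor_ext {x : M} {u v : ProjCotractor n x} (hμ : projMu nabla x u = projMu nabla x v)
    (hσ : projSigma nabla x u = projSigma nabla x v) : u = v :=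
  (projSplit nabla _ x).injective (Prod.ext hμ hσ)

lemma projMu_projTractorConn (U : Π x : M, ProjCotractor n x) (x : M) (X : TangentSpace (𝓡 n) x) :
    projMu nabla x (projTractorConn nabla U x X) =
      densityFormDeriv nabla (fun y ↦ projMu nabla y (U y)) x X +
        (stdBasis n x).constr ℝ (fun i ↦
          projSchouten nabla x X (stdBasis n x i) • projSigma nabla x (U x)) := by
  rw [projTractorConn, projMu, LinearMap.comp_apply, LinearEquiv.coe_coe,
    LinearEquiv.apply_symm_apply]
  rfl

lemma projSigma_projTractorConn (U : Π x : M, ProjCotractor n x) (x : M)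
    (X : TangentSpace (𝓡 n) x) :
    projSigma nabla x (projTractorConn nabla U x X) =
      densityDeriv nabla (fun y ↦ projSigma nabla y (U y)) x X - projMu nabla x (U x) X := by
  rw [projTractorConn, projSigma, LinearMap.comp_apply, LinearEquiv.coe_coe,
    LinearEquiv.apply_symm_apply]
  rfl

/-- The weight slot of the splitting by a connection is the projection `J¹ 𝓔(1) → 𝓔(1)`. -/
lemma jetEval_eq_projSigma (x : M) : jetEval _ x = projSigma nabla x := by
  refine LinearMap.ext fun u ↦ ?_
  obtain ⟨s, rfl⟩ := Submodule.mkQ_surjective _ u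
  rfl

/-- A projective cotractor may be prescribed by its slots, read in the trivialisation by `g`. -/
lemma exists_projCotractor (g : PseudoMetric n M) (nabla : AffineConnection n M) (x : M)
    (θ : TangentSpace (𝓡 n) x →ₗ[ℝ] ℝ) (a : ℝ) :
    ∃ u : ProjCotractor n x, scale g _ x ∘ₗ projMu nabla x u = θ ∧
      scale g _ x (projSigma nabla x u) = a := by
  obtain ⟨σ, hσ⟩ := scale_surjective (g := g) ((1 : ℝ) / (n + 1)) x a
  let e := LinearEquiv.ofBijective (scale g ((1 : ℝ) / (n + 1)) x)
    ⟨scale_injective _ x, scale_surjective _ x⟩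
  refine ⟨(projSplit nabla _ x).symm (e.symm.toLinearMap ∘ₗ θ, σ), ?_, ?_⟩
  · rw [projMu, LinearMap.comp_apply, LinearEquiv.coe_coe, LinearEquiv.apply_symm_apply]
    exact LinearMap.ext fun v ↦ e.apply_symm_apply (θ v)
  · rw [projSigma, LinearMap.comp_apply, LinearEquiv.coe_coe, LinearEquiv.apply_symm_apply]
    exact hσ

variable [NeZero n]

lemma confCotractor_ext {x : M} {u v : ConfCotractor g x}
    (hτ : confTau g nabla x u = confTau g nabla x v)
    (hμ : confMu g nabla x u = confMu g nabla x v)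
    (hσ : confSigma g nabla x u = confSigma g nabla x v) : u = v :=
  (confSplit g nabla x).injective (Prod.ext hτ (Prod.ext hμ hσ))

lemma confTau_confSplit_symm (x : M) (p : ℝ × (TangentSpace (𝓡 n) x →ₗ[ℝ] ℝ) × ℝ) :
    confTau g nabla x ((confSplit g nabla x).symm p) = p.1 :=
  congrArg Prod.fst ((confSplit g nabla x).apply_symm_apply p)

lemma confMu_confSplit_symm (x : M) (p : ℝ × (TangentSpace (𝓡 n) x →ₗ[ℝ] ℝ) × ℝ) :
    confMu g nabla x ((confSplit g nabla x).symm p) = p.2.1 :=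
  congrArg (fun q ↦ q.2.1) ((confSplit g nabla x).apply_symm_apply p)

lemma confSigma_confSplit_symm (x : M) (p : ℝ × (TangentSpace (𝓡 n) x →ₗ[ℝ] ℝ) × ℝ) :
    confSigma g nabla x ((confSplit g nabla x).symm p) = p.2.2 :=
  congrArg (fun q ↦ q.2.2) ((confSplit g nabla x).apply_symm_apply p)

lemma confTau_iota (x : M) (u : ProjCotractor n x) :
    confTau g nabla x (iota g nabla x u) =
      confJ g nabla x / n * scale g _ x (projSigma nabla x u) :=
  confTau_confSplit_symm x _

lemma confMu_iota (x : M) (u : ProjCotractor n x) :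
    confMu g nabla x (iota g nabla x u) = scale g _ x ∘ₗ projMu nabla x u :=
  confMu_confSplit_symm x _

lemma confSigma_iota (x : M) (u : ProjCotractor n x) :
    confSigma g nabla x (iota g nabla x u) = scale g _ x (projSigma nabla x u) :=
  confSigma_confSplit_symm x _

end Slots

/-! ### The sub-metric and the map `ι` -/

section Comparison

variable [T2Space M]

lemma IsSmoothProj.contMDiffAt_scale_projSigma {U : Π x : M, ProjCotractor n x}
    (hU : IsSmoothProj nabla U) (x : M) :
    ContMDiffAt (𝓡 n) 𝓘(ℝ, ℝ) ∞ (fun y ↦ scale g _ y (projSigma nabla y (U y))) x :=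
  contMDiffAt_scale (hU x).1

lemma IsSmoothProj.contMDiffAt_scale_projMu {U : Π x : M, ProjCotractor n x}
    (hU : IsSmoothProj nabla U) (x : M) (i : Fin n) :
    ContMDiffAt (𝓡 n) 𝓘(ℝ, ℝ) ∞
      (fun y ↦ (scale g _ y ∘ₗ projMu nabla y (U y)) (coordFrame x y i)) x :=
  contMDiffAt_scale ((hU x).2 i)

/-- For an Einstein metric, with `P = lam g`, the first slot of the projective tractor derivative
is `∇_X μ + lam σ g(X, ·)` in the trivialisation by `g`. -/
lemma scale_comp_projMu_projTractorConn (hLC : IsLeviCivita g nabla) {lam : ℝ}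
    (hP : ∀ (x : M) (u v : TangentSpace (𝓡 n) x), projSchouten nabla x u v = lam * g.val x u v)
    {U : Π x : M, ProjCotractor n x} (hU : IsSmoothProj nabla U) (x : M)
    (X : TangentSpace (𝓡 n) x) :
    scale g _ x ∘ₗ projMu nabla x (projTractorConn nabla U x X) =
      formDeriv nabla (fun y ↦ scale g _ y ∘ₗ projMu nabla y (U y)) x X +
        (lam * scale g _ x (projSigma nabla x (U x))) •
          (g.val x X : TangentSpace (𝓡 n) x →ₗ[ℝ] ℝ) := by
  rw [projMu_projTractorConn, LinearMap.comp_add,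
    scale_comp_densityFormDeriv hLC fun i ↦ (hU x).2 i]
  congr 1
  refine (stdBasis n x).ext fun i ↦ ?_
  rw [LinearMap.comp_apply, Basis.constr_basis, map_smul, hP]
  simp only [smul_eq_mul, LinearMap.smul_apply, ContinuousLinearMap.coe_coe]
  ring

lemma scale_projSigma_projTractorConn (hLC : IsLeviCivita g nabla)
    {U : Π x : M, ProjCotractor n x} (hU : IsSmoothProj nabla U) (x : M)
    (X : TangentSpace (𝓡 n) x) :
    scale g _ x (projSigma nabla x (projTractorConn nabla U x X)) =
      mvfderiv (𝓡 n) (fun y ↦ scale g _ y (projSigma nabla y (U y))) x X -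
        scale g _ x (projMu nabla x (U x) X) := by
  rw [projSigma_projTractorConn, map_sub, scale_densityDeriv hLC (hU x).1]

/-- The sub-metric of an Einstein metric is smooth, symmetric and nondegenerate on
`ker (J¹ 𝓔(1) → 𝓔(1))`, where it is the inverse metric. -/
lemma isSubMetric_projSubMetric (lam : ℝ) :
    IsSubMetric nabla fun x ↦ projSubMetric g nabla lam x where
  smooth U U' hU hU' x :=
    (contMDiffAt_cometric (hU.contMDiffAt_scale_projMu x) (hU'.contMDiffAt_scale_projMu x)).add
      (contMDiffAt_const.mul
        ((hU.contMDiffAt_scale_projSigma x).mul (hU'.contMDiffAt_scale_projSigma x)))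
  symm x u v := by
    simp only [projSubMetric, LinearMap.mk₂_apply]
    rw [cometric_comm]
    ring
  nondegenerate x u hu h0 := by
    rw [jetEval_eq_projSigma (nabla := nabla)] at hu
    have h1 : scale g _ x ∘ₗ projMu nabla x u = 0 := by
      refine eq_zero_of_cometric_eq_zero g fun ν ↦ ?_
      obtain ⟨v, hv, hv'⟩ := exists_projCotractor g nabla x ν 0
      have hv0 : projSigma nabla x v = 0 := scale_injective (g := g) _ x (by rw [hv', map_zero])
      have h := h0 v (by rw [jetEval_eq_projSigma (nabla := nabla), hv0])
      simpa only [projSubMetric, LinearMap.mk₂_apply, hv, hv', mul_zero, add_zero] using h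
    refine projCotractor_ext (nabla := nabla) ?_ (by rw [hu, map_zero])
    rw [map_zero]
    refine LinearMap.ext fun X ↦ scale_injective (g := g) _ x ?_
    rw [LinearMap.zero_apply, map_zero]
    exact LinearMap.congr_fun h1 X

/-- When `P = lam g`, the sub-metric is parallel: the terms `lam σ g(X, ·)` and `-μ(X)` of the
tractor connection cancel in pairs. -/
lemma isParallelForm_projSubMetric (hLC : IsLeviCivita g nabla) {lam : ℝ}
    (hP : ∀ (x : M) (u v : TangentSpace (𝓡 n) x), projSchouten nabla x u v = lam * g.val x u v) :
    IsParallelForm nabla fun x ↦ projSubMetric g nabla lam x := by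
  intro U U' hU hU' x X
  have hμ := hU.contMDiffAt_scale_projMu (g := g) x
  have hμ' := hU'.contMDiffAt_scale_projMu (g := g) x
  have hσ := hU.contMDiffAt_scale_projSigma (g := g) x
  have hσ' := hU'.contMDiffAt_scale_projSigma (g := g) x
  have hC := contMDiffAt_cometric (g := g) hμ hμ'
  have hlhs : mvfderiv (𝓡 n) (fun y ↦ projSubMetric g nabla lam y (U y) (U' y)) x X = _ :=
    mvfderiv_eq_of_hasDerivAt_chartLine
      ((hC.add (contMDiffAt_const.mul (hσ.mul hσ'))).mdifferentiableAt (by simp))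
      (Filter.EventuallyEq.refl _ _)
      ((hasDerivAt_chartLine (hC.mdifferentiableAt (by simp)) X).add
        (((hasDerivAt_chartLine (hσ.mdifferentiableAt (by simp)) X).mul
          (hasDerivAt_chartLine (hσ'.mdifferentiableAt (by simp)) X)).const_mul lam))
  have h0 : ∀ W : Π x : M, ProjCotractor n x,
      scale g _ (chartLine x X 0) (projSigma nabla _ (W (chartLine x X 0))) =
        scale g _ x (projSigma nabla x (W x)) := fun W ↦
    congrArg (fun y ↦ scale g _ y (projSigma nabla y (W y))) (chartLine_zero x X)
  rw [hlhs, mvfderiv_cometric hLC hμ hμ', h0, h0]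
  simp only [projSubMetric, LinearMap.mk₂_apply]
  rw [scale_comp_projMu_projTractorConn hLC hP hU, scale_comp_projMu_projTractorConn hLC hP hU',
    scale_projSigma_projTractorConn hLC hU, scale_projSigma_projTractorConn hLC hU',
    cometric_add_left, cometric_add_right, cometric_smul_left, cometric_smul_right,
    cometric_comm g x _ (g.val x X : TangentSpace (𝓡 n) x →ₗ[ℝ] ℝ), cometric_val_left,
    cometric_val_left]
  simp only [LinearMap.comp_apply]
  ring

variable [NeZero n]

lemma tractorI_apply (x : M) (v : ConfCotractor g x) :
    tractorI g nabla x v = confTau g nabla x v - confJ g nabla x / n * confSigma g nabla x v :=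
  rfl

lemma isSmoothConf_iota {b : ℝ} (hJ : ∀ x : M, confJ g nabla x = n * b)
    {U : Π x : M, ProjCotractor n x} (hU : IsSmoothProj nabla U) :
    IsSmoothConf g nabla fun x ↦ iota g nabla x (U x) := by
  refine ⟨fun x ↦ ?_, fun x i ↦ ?_, fun x ↦ ?_⟩
  · simp only [confTau_iota, hJ]
    exact contMDiffAt_const.mul (hU.contMDiffAt_scale_projSigma x)
  · simp only [confMu_iota]
    exact hU.contMDiffAt_scale_projMu x i
  · simp only [confSigma_iota]
    exact hU.contMDiffAt_scale_projSigma x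

lemma iota_injective (x : M) : Function.Injective (iota g nabla x) := by
  intro u v h
  have hμ := congrArg (confMu g nabla x) h
  have hσ := congrArg (confSigma g nabla x) h
  rw [confMu_iota, confMu_iota] at hμ
  rw [confSigma_iota, confSigma_iota] at hσ
  exact projCotractor_ext
    (LinearMap.ext fun X ↦ scale_injective (g := g) _ x (LinearMap.congr_fun hμ X))
    (scale_injective (g := g) _ x hσ)

/-- The image of `ι` is the kernel of `I`: both are cut out by `τ = (J̃/n) σ`. -/
lemma range_iota (x : M) :
    LinearMap.range (iota g nabla x) = LinearMap.ker (tractorI g nabla x) := by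
  ext v
  rw [LinearMap.mem_range, LinearMap.mem_ker, tractorI_apply]
  constructor
  · rintro ⟨u, rfl⟩
    rw [confTau_iota, confSigma_iota, sub_self]
  · intro hv
    obtain ⟨u, hμ, hσ⟩ :=
      exists_projCotractor g nabla x (confMu g nabla x v) (confSigma g nabla x v)
    refine ⟨u, confCotractor_ext (nabla := nabla) ?_ ?_ ?_⟩
    · rw [confTau_iota, hσ, sub_eq_zero.1 hv]
    · rw [confMu_iota, hμ]
    · rw [confSigma_iota, hσ]

/-- When `P̃ = b g` with `b = J̃/n` constant, the derivative of `I` applied to `(τ ∣ μ ∣ σ)` is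
`-P̃(X, ·)ᵃ μₐ + b μ(X) = 0`. -/
lemma isParallelTractor_tractorI {b : ℝ} (hJ : ∀ x : M, confJ g nabla x = n * b)
    (hPt : ∀ (x : M) (u v : TangentSpace (𝓡 n) x), confSchouten g nabla x u v = b * g.val x u v) :
    IsParallelTractor g nabla fun x ↦ tractorI g nabla x := by
  have hn : (n : ℝ) ≠ 0 := Nat.cast_ne_zero.2 (NeZero.ne n)
  have hI : ∀ (x : M) (v : ConfCotractor g x), tractorI g nabla x v =
      confTau g nabla x v - b * confSigma g nabla x v := fun x v ↦ by
    rw [tractorI_apply, hJ, mul_div_cancel_left₀ _ hn]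
  intro V hV
  simp only [hI]
  have hσ : ∀ x, ContMDiffAt (𝓡 n) 𝓘(ℝ, ℝ) ∞ (fun y ↦ b * confSigma g nabla y (V y)) x :=
    fun x ↦ contMDiffAt_const.mul (hV.2.2 x)
  have hsm : ContMDiff (𝓡 n) 𝓘(ℝ, ℝ) ∞
      (fun y ↦ confTau g nabla y (V y) - b * confSigma g nabla y (V y)) :=
    fun x ↦ (hV.1 x).sub (hσ x)
  refine ⟨hsm, fun x X ↦ ?_⟩
  have hd : mvfderiv (𝓡 n) (fun y ↦ confTau g nabla y (V y) - b * confSigma g nabla y (V y)) x X =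
      mvfderiv (𝓡 n) (fun y ↦ confTau g nabla y (V y)) x X -
        b * mvfderiv (𝓡 n) (fun y ↦ confSigma g nabla y (V y)) x X :=
    mvfderiv_eq_of_hasDerivAt_chartLine ((hsm x).mdifferentiableAt (by simp))
      (Filter.EventuallyEq.refl _ _)
      ((hasDerivAt_chartLine ((hV.1 x).mdifferentiableAt (by simp)) X).sub
        ((hasDerivAt_chartLine ((hV.2.2 x).mdifferentiableAt (by simp)) X).const_mul b))
  have htr : metricTrace g x (fun u v ↦ confSchouten g nabla x X u * confMu g nabla x (V x) v) =
      b * confMu g nabla x (V x) X := by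
    rw [← cometric_val_left g x X, ← cometric_smul_left]
    refine Finset.sum_congr rfl fun i _ ↦ Finset.sum_congr rfl fun j _ ↦ ?_
    simp only [hPt, LinearMap.smul_apply, ContinuousLinearMap.coe_coe, smul_eq_mul]
    ring
  rw [hd, confTractorConn, confTau_confSplit_symm, confSigma_confSplit_symm, htr]
  ring

/-- The two tractor connections correspond under `ι`. With `P̃ = b g` and `τ = b σ`, the middle slot
has the terms `g(X, ·) τ + P̃(X, ·) σ = 2 b σ g(X, ·)`, which is `P(X, ·) σ`. -/
lemma confTractorConn_iota (hLC : IsLeviCivita g nabla) {b : ℝ}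
    (hJ : ∀ x : M, confJ g nabla x = n * b)
    (hPt : ∀ (x : M) (u v : TangentSpace (𝓡 n) x), confSchouten g nabla x u v = b * g.val x u v)
    (hP : ∀ (x : M) (u v : TangentSpace (𝓡 n) x),
      projSchouten nabla x u v = (2 * b) * g.val x u v)
    {U : Π x : M, ProjCotractor n x} (hU : IsSmoothProj nabla U) (x : M)
    (X : TangentSpace (𝓡 n) x) :
    confTractorConn g nabla (fun y ↦ iota g nabla y (U y)) x X =
      iota g nabla x (projTractorConn nabla U x X) := by
  have hn : (n : ℝ) ≠ 0 := Nat.cast_ne_zero.2 (NeZero.ne n)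
  have hτ : ∀ (x : M) (u : ProjCotractor n x), confTau g nabla x (iota g nabla x u) =
      b * scale g _ x (projSigma nabla x u) := fun x u ↦ by
    rw [confTau_iota, hJ, mul_div_cancel_left₀ _ hn]
  have hσ : confSigma g nabla x (confTractorConn g nabla (fun y ↦ iota g nabla y (U y)) x X) =
      confSigma g nabla x (iota g nabla x (projTractorConn nabla U x X)) := by
    rw [confTractorConn, confSigma_confSplit_symm,
      confSigma_iota x (projTractorConn nabla U x X), scale_projSigma_projTractorConn hLC hU]
    simp only [confSigma_iota, confMu_iota, LinearMap.comp_apply]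
  -- both sides lie in the kernel of the parallel tractor `I`, so the first slots agree as well
  have hI := isParallelTractor_tractorI hJ hPt _ (isSmoothConf_iota hJ hU)
  have hker : ∀ (y : M) (u : ProjCotractor n y),
      tractorI g nabla y (iota g nabla y u) = 0 := fun y u ↦
    LinearMap.mem_ker.1 (range_iota (g := g) (nabla := nabla) y ▸ LinearMap.mem_range_self _ u)
  have h0 := hI.2 x X
  simp only [hker] at h0
  rw [mvfderiv_const, tractorI_apply, hσ] at h0
  have h1 := hker x (projTractorConn nabla U x X)
  rw [tractorI_apply] at h1
  refine confCotractor_ext (nabla := nabla) ?_ ?_ hσ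
  · have h2 := h0.symm.trans (zero_apply X)
    linarith
  · rw [confTractorConn, confMu_confSplit_symm,
      confMu_iota x (projTractorConn nabla U x X), scale_comp_projMu_projTractorConn hLC hP hU]
    simp only [confMu_iota, hτ, confSigma_iota, hPt]
    congr 1
    refine (stdBasis n x).ext fun i ↦ ?_
    rw [Basis.constr_basis]
    simp only [LinearMap.smul_apply, ContinuousLinearMap.coe_coe, smul_eq_mul]
    ring

/-- The sub-metric with `lam = 2 b` is the pull-back of the tractor metric: with `τ = b σ` the mixed
terms `σ τ' + τ σ'` add up to `2 b σ σ'`. -/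
lemma confTractorMetric_iota {b : ℝ} (hJ : ∀ x : M, confJ g nabla x = n * b) (x : M)
    (u v : ProjCotractor n x) :
    confTractorMetric g nabla x (iota g nabla x u) (iota g nabla x v) =
      projSubMetric g nabla (2 * b) x u v := by
  have hn : (n : ℝ) ≠ 0 := Nat.cast_ne_zero.2 (NeZero.ne n)
  simp only [confTractorMetric, confTau_iota, confMu_iota, confSigma_iota, projSubMetric,
    LinearMap.mk₂_apply, hJ, mul_div_cancel_left₀ _ hn]
  ring

end Comparison

end Tractor

theorem mainTheorem11 {n : ℕ} [NeZero n] (hn : 3 ≤ n) {M : Type*} [TopologicalSpace M]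
    [ChartedSpace (EuclideanSpace ℝ (Fin n)) M] [IsManifold (𝓡 n) ∞ M] [T2Space M]
    (g : Tractor.PseudoMetric n M) (nabla : Tractor.AffineConnection n M)
    (hLC : Tractor.IsLeviCivita g nabla) (hE : Tractor.IsEinstein g nabla) :
    Tractor.IsParallelTractor g nabla (fun x ↦ Tractor.tractorI g nabla x) ∧
    (∀ U : Π x : M, Tractor.ProjCotractor n x, Tractor.IsSmoothProj nabla U →
      Tractor.IsSmoothConf g nabla (fun x ↦ Tractor.iota g nabla x (U x))) ∧
    (∀ x : M, Function.Injective (Tractor.iota g nabla x) ∧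
      LinearMap.range (Tractor.iota g nabla x) = LinearMap.ker (Tractor.tractorI g nabla x)) ∧
    (∀ U : Π x : M, Tractor.ProjCotractor n x, Tractor.IsSmoothProj nabla U →
      ∀ (x : M) (X : TangentSpace (𝓡 n) x),
        Tractor.confTractorConn g nabla (fun y ↦ Tractor.iota g nabla y (U y)) x X =
          Tractor.iota g nabla x (Tractor.projTractorConn nabla U x X)) ∧
    ∃ lam : ℝ,
      (∀ (x : M) (u v : TangentSpace (𝓡 n) x),
        Tractor.projSchouten nabla x u v = lam * g.val x u v) ∧
      Tractor.IsSubMetric nabla (fun x ↦ Tractor.projSubMetric g nabla lam x) ∧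
      Tractor.IsParallelForm nabla (fun x ↦ Tractor.projSubMetric g nabla lam x) ∧
      ∀ (x : M) (u v : Tractor.ProjCotractor n x),
        Tractor.confTractorMetric g nabla x (Tractor.iota g nabla x u)
          (Tractor.iota g nabla x v) = Tractor.projSubMetric g nabla lam x u v := by
  obtain ⟨c, hc⟩ := hE
  -- for `Ric = c g` one has `J̃/n = b`, `P̃ = b g` and `P = 2 b g`
  set b : ℝ := c / (2 * ((n : ℝ) - 1)) with hb
  have hJ : ∀ x : M, Tractor.confJ g nabla x = n * b := Tractor.confJ_of_einstein hc
  have hPt := Tractor.confSchouten_of_einstein hc hn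
  have hP : ∀ (x : M) (u v : TangentSpace (𝓡 n) x),
      Tractor.projSchouten nabla x u v = 2 * b * g.val x u v := by
    intro x u v
    have h2 : 2 * b = c / ((n : ℝ) - 1) := by
      rw [hb, ← mul_div_assoc, mul_div_mul_left _ _ two_ne_zero]
    rw [h2]
    exact Tractor.projSchouten_of_einstein hc hn x u v
  exact ⟨Tractor.isParallelTractor_tractorI hJ hPt, fun U hU ↦ Tractor.isSmoothConf_iota hJ hU,
    fun x ↦ ⟨Tractor.iota_injective x, Tractor.range_iota x⟩,
    fun U hU x X ↦ Tractor.confTractorConn_iota hLC hJ hPt hP hU x X,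
    2 * b, hP, Tractor.isSubMetric_projSubMetric _, Tractor.isParallelForm_projSubMetric hLC hP,
    Tractor.confTractorMetric_iota hJ⟩
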